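/- Let $n\in\mathbb N$ and let $\mathbb C_+$ be the open upper half-plane. For $M\in M_n(\mathbb C)$ put $\operatorname{Im}M=(M-M^*)/(2i)$. A Herglotz matrix is an analytic map $M:\mathbb C_+\to M_n(\mathbb C)$ with $\operatorname{Im}M(z)\ge 0$ for all $z\in\mathbb C_+$; its measure $\Omega$ is the nonnegative $n\times n$ matrix-valued measure on the bounded Borel subsets of $\mathbb R$ in the representation $$M(z)=C+Dz+\int_{\mathbb R}d\Omega(\lambda)\Big(\frac1{\lambda-z}-\frac{\lambda}{1+\lambda^2}\Big),\qquad z\in\mathbb C_+,$$ where $C=C^*$, $D\ge 0$ and $\int_{\mathbb R}(1+\lambda^2)^{-1}(x,d\Omega(\lambda)x)<\infty$ for all $x\in\mathbb C^n$. Let $\Omega_{ac}$ be its absolutely continuous part with respect to Lebesgue measure $|\cdot|$, write $M(\lambda+i0)=\lim_{\varepsilon\downarrow0}M(\lambda+i\varepsilon)$, and for $1\le r\le n$ put $$S_{\Omega_{ac},r}=\{\lambda\in\mathbb R: M(\lambda+i0)\text{ exists finitely and }\operatorname{rank}\operatorname{Im}M(\lambda+i0)=r\},\qquad S_{\Omega_{ac}}=\bigcup_{r=1}^nS_{\Omega_{ac},r}.$$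 Let $\mathcal E_r(\Omega_{ac})$ and $\mathcal E(\Omega_{ac})$ be the classes of $S_{\Omega_{ac},r}$ and of $S_{\Omega_{ac}}$ under the equivalence relation $S\sim T\iff\Omega_{ac}(S\triangle T)=0=|S\triangle T|$ on subsets of $\mathbb R$. A set $S\subseteq\mathbb R$ is a support of $\Omega_{ac}$ if $\Omega_{ac}(\mathbb R\setminus S)=0$, and a minimal support if moreover $|S\setminus T|=0$ for every support $T\subseteq S$ of $\Omega_{ac}$. A matrix measure is a discrete point measure if it is carried by the set of its atoms and this set has no finite accumulation point (the zero measure is included). Two matrix measures are equivalent ($\sim$) if they have the same null sets. Let $\mathcal A_{2n}=\{A\in M_{2n}(\mathbb C):A^*J_{2n}A=J_{2n}\}$, $J_{2n}=\begin{pmatrix}0&-I_n\\I_n&0\end{pmatrix}$. For a Herglotz matrix $M$, call $A=(A_{p,q})_{1\le p,q\le2}\in\mathcal A_{2n}$ admissible if $\ker(A_{1,1}+A_{1,2}M(z))=\{0\}$ for all $z\in\mathbb C_+$, and then put $$M_A(z)=(A_{2,1}+A_{2,2}M(z))(A_{1,1}+A_{1,2}M(z))^{-1},\qquad z\in\mathbb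 C_+.$$ **Theorem.** Let $M$ be an $n\times n$ Herglotz matrix with measure $\Omega$ and, for admissible $A$, let $\Omega_A$ be the measure of $M_A$. Then $\mathcal E(\Omega_{ac})$ is the set of all minimal supports of $\Omega_{ac}$, and: (i) For every admissible $A$, $\mathcal E_r(\Omega_{A,ac})=\mathcal E_r(\Omega_{ac})$ for $1\le r\le n$, $\mathcal E(\Omega_{A,ac})=\mathcal E(\Omega_{ac})$, and $\Omega_{A,ac}\sim\Omega_{ac}$, where the sets $S_{\Omega_{A,ac},r}$ and $S_{\Omega_{A,ac}}$ are formed with $M_A$ in place of $M$. (ii) If $\Omega_B$ is a discrete point measure for some admissible $B$, then $\Omega_A$ is a discrete point measure for every admissible $A$. (iii) The set $$S=\{\lambda\in\mathbb R:\text{there is no admissible }A\text{ for which }\operatorname{Im}M_A(\lambda+i0)\text{ exists and equals }0\}$$ belongs to $\mathcal E(\Omega_{ac})$; that is, $S$ is a minimal support of $\Omega_{ac}$. -/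

import Mathlib

open MeasureTheory Filter Topology
open scoped ComplexOrder ENNReal

noncomputable section

/-- A nonnegative `n × n` matrix-valued measure on the bounded Borel subsets of `ℝ`: each bounded
Borel set is mapped to a nonnegative matrix, countably additively as long as the union is bounded.
Values of `toFun` on other sets carry no meaning and are never used. -/
structure MatrixMeasure (n : ℕ) where
  toFun : Set ℝ → Matrix (Fin n) (Fin n) ℂ
  posSemidef' : ∀ X : Set ℝ, MeasurableSet X → Bornology.IsBounded X → (toFun X).PosSemidef
  empty' : toFun ∅ = 0
  hasSum_iUnion' : ∀ X : ℕ → Set ℝ, (∀ i, MeasurableSet (X i)) →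
    Pairwise (fun i j => Disjoint (X i) (X j)) → Bornology.IsBounded (⋃ i, X i) →
    ∀ j k, HasSum (fun i => toFun (X i) j k) (toFun (⋃ i, X i) j k)

namespace MatrixMeasure

variable {n : ℕ}

/-- The set function `X ↦ (x, Ω(X) x)` (a nonnegative real number for bounded Borel `X`). -/
def quad (Ω : MatrixMeasure n) (x : Fin n → ℂ) (X : Set ℝ) : ℝ :=
  (star x ⬝ᵥ ((Ω.toFun X).mulVec x)).re

lemma quad_nonneg (Ω : MatrixMeasure n) (x : Fin n → ℂ) {X : Set ℝ} (hX : MeasurableSet X)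
    (hb : Bornology.IsBounded X) : 0 ≤ Ω.quad x X :=
  (Complex.le_def.1 ((Ω.posSemidef' X hX hb).dotProduct_mulVec_nonneg x)).1

lemma quad_hasSum (Ω : MatrixMeasure n) (x : Fin n → ℂ) (X : ℕ → Set ℝ)
    (hX : ∀ i, MeasurableSet (X i)) (hd : Pairwise (fun i j => Disjoint (X i) (X j)))
    (hb : Bornology.IsBounded (⋃ i, X i)) :
    HasSum (fun i => Ω.quad x (X i)) (Ω.quad x (⋃ i, X i)) := by
  unfold quad
  refine Complex.hasSum_re ?_
  simp only [dotProduct, Matrix.mulVec]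
  refine hasSum_sum fun j _ => HasSum.mul_left _ ?_
  exact hasSum_sum fun k _ => (Ω.hasSum_iUnion' X hX hd hb j k).mul_right _

lemma isBounded_inter_Ico (s : Set ℝ) (k : ℤ) :
    Bornology.IsBounded (s ∩ Set.Ico (k : ℝ) (k + 1)) :=
  (Metric.isBounded_Ico (k : ℝ) (k + 1)).subset Set.inter_subset_right

/-- The Borel measure on `ℝ` extending `X ↦ (x, Ω(X) x)` from bounded Borel sets to all Borel
sets; see `quadMeasure_apply`. -/
def quadMeasure (Ω : MatrixMeasure n) (x : Fin n → ℂ) : Measure ℝ :=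
  Measure.ofMeasurable
    (fun s _ => ∑' k : ℤ, ENNReal.ofReal (Ω.quad x (s ∩ Set.Ico (k : ℝ) (k + 1))))
    (by simp [quad, Ω.empty'])
    (by
      intro f hf hd
      rw [ENNReal.tsum_comm]
      refine tsum_congr fun k => ?_
      have h := Ω.quad_hasSum x (fun i => f i ∩ Set.Ico (k : ℝ) (k + 1))
        (fun i => (hf i).inter measurableSet_Ico)
        (fun i j hij => (hd hij).mono Set.inter_subset_left Set.inter_subset_left)
        (by rw [← Set.iUnion_inter]; exact isBounded_inter_Ico _ k)
      rw [Set.iUnion_inter, ← h.tsum_eq, ENNReal.ofReal_tsum_of_nonneg _ h.summable]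
      exact fun i => Ω.quad_nonneg x ((hf i).inter measurableSet_Ico) (isBounded_inter_Ico _ k))

lemma quadMeasure_apply (Ω : MatrixMeasure n) (x : Fin n → ℂ) {X : Set ℝ} (hX : MeasurableSet X)
    (hb : Bornology.IsBounded X) : Ω.quadMeasure x X = ENNReal.ofReal (Ω.quad x X) := by
  rw [quadMeasure, Measure.ofMeasurable_apply _ hX]
  have e : (∑' k : ℤ, ENNReal.ofReal (Ω.quad x (X ∩ Set.Ico (k : ℝ) (k + 1)))) =
      ∑' i : ℕ, ENNReal.ofReal (Ω.quad x (X ∩ Set.Ico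
        (((Equiv.intEquivNat.symm i : ℤ)) : ℝ) ((Equiv.intEquivNat.symm i : ℤ) + 1))) :=
    (Equiv.tsum_eq Equiv.intEquivNat.symm
      (fun k : ℤ => ENNReal.ofReal (Ω.quad x (X ∩ Set.Ico (k : ℝ) (k + 1))))).symm
  have hU : (⋃ i : ℕ, X ∩ Set.Ico
      (((Equiv.intEquivNat.symm i : ℤ)) : ℝ) ((Equiv.intEquivNat.symm i : ℤ) + 1)) = X := by
    rw [← Set.inter_iUnion]
    refine Set.inter_eq_left.2 fun y _ => ?_
    refine Set.mem_iUnion.2 ⟨Equiv.intEquivNat ⌊y⌋, ?_⟩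
    simp only [Equiv.symm_apply_apply]
    exact ⟨Int.floor_le y, Int.lt_floor_add_one y⟩
  have h := Ω.quad_hasSum x (fun i : ℕ => X ∩ Set.Ico
      (((Equiv.intEquivNat.symm i : ℤ)) : ℝ) ((Equiv.intEquivNat.symm i : ℤ) + 1))
    (fun i => hX.inter measurableSet_Ico)
    (fun i j hij => by
      have : (Equiv.intEquivNat.symm i : ℤ) ≠ Equiv.intEquivNat.symm j :=
        fun h => hij (Equiv.intEquivNat.symm.injective h)
      exact ((Set.pairwise_disjoint_Ico_intCast ℝ) this).mono
        Set.inter_subset_right Set.inter_subset_right)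
    (by rw [hU]; exact hb)
  rw [e, ← ENNReal.ofReal_tsum_of_nonneg _ h.summable, h.tsum_eq, hU]
  exact fun i => Ω.quad_nonneg x (hX.inter measurableSet_Ico) (isBounded_inter_Ico _ _)

/-- The trace measure `tr Ω = Ω₁₁ + ⋯ + Ωₙₙ`, as a Borel measure on `ℝ`. -/
def trace (Ω : MatrixMeasure n) : Measure ℝ :=
  ∑ j : Fin n, Ω.quadMeasure (Pi.single j 1)

lemma quad_single (Ω : MatrixMeasure n) (j : Fin n) (X : Set ℝ) :
    Ω.quad (Pi.single j 1) X = (Ω.toFun X j j).re := by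
  simp [quad]

/-- The trace measure has the same null sets as the matrix measure. -/
lemma trace_eq_zero_iff (Ω : MatrixMeasure n) {X : Set ℝ} (hX : MeasurableSet X)
    (hb : Bornology.IsBounded X) : Ω.trace X = 0 ↔ Ω.toFun X = 0 := by
  have hp := Ω.posSemidef' X hX hb
  have hj : ∀ j, 0 ≤ Ω.toFun X j j := fun j => hp.diag_nonneg
  rw [trace, Measure.finsetSum_apply, Finset.sum_eq_zero_iff, ← hp.trace_eq_zero_iff,
    Matrix.trace, Finset.sum_eq_zero_iff_of_nonneg (fun j _ => by simpa using hj j)]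
  refine forall_congr' fun j => forall_congr' fun _ => ?_
  rw [Ω.quadMeasure_apply _ hX hb, quad_single, ENNReal.ofReal_eq_zero, Matrix.diag_apply]
  have h0 := Complex.le_def.1 (hj j)
  constructor
  · intro h
    exact Complex.ext (le_antisymm h h0.1) h0.2.symm
  · intro h
    simp [h]

instance (Ω : MatrixMeasure n) : IsLocallyFiniteMeasure Ω.trace := by
  refine ⟨fun a => ⟨Metric.ball a 1, Metric.ball_mem_nhds a one_pos, ?_⟩⟩
  rw [trace, Measure.finsetSum_apply]
  refine ENNReal.sum_lt_top.2 fun j _ => ?_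
  rw [Ω.quadMeasure_apply _ Metric.isOpen_ball.measurableSet Metric.isBounded_ball]
  exact ENNReal.ofReal_lt_top

/-- The restriction `X ↦ Ω(X ∩ N)` of `Ω` to a Borel set `N`. -/
def restrict (Ω : MatrixMeasure n) (N : Set ℝ) (hN : MeasurableSet N) : MatrixMeasure n where
  toFun X := Ω.toFun (X ∩ N)
  posSemidef' X hX hb := Ω.posSemidef' _ (hX.inter hN) (hb.subset Set.inter_subset_left)
  empty' := by simp [Ω.empty']
  hasSum_iUnion' X hX hd hb := by
    have h := Ω.hasSum_iUnion' (fun i => X i ∩ N) (fun i => (hX i).inter hN)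
      (fun i j hij => (hd hij).mono Set.inter_subset_left Set.inter_subset_left)
      (by rw [← Set.iUnion_inter]; exact hb.subset Set.inter_subset_left)
    rw [← Set.iUnion_inter] at h
    exact h

lemma quadMeasure_restrict (Ω : MatrixMeasure n) (N : Set ℝ) (hN : MeasurableSet N)
    (x : Fin n → ℂ) : (Ω.restrict N hN).quadMeasure x = (Ω.quadMeasure x).restrict N := by
  ext X hX
  rw [Measure.restrict_apply hX, quadMeasure, Measure.ofMeasurable_apply _ hX, quadMeasure,
    Measure.ofMeasurable_apply _ (hX.inter hN)]
  refine tsum_congr fun k => ?_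
  simp only [quad, restrict]
  rw [Set.inter_right_comm]

lemma trace_restrict (Ω : MatrixMeasure n) (N : Set ℝ) (hN : MeasurableSet N) :
    (Ω.restrict N hN).trace = Ω.trace.restrict N := by
  simp only [trace, quadMeasure_restrict]
  ext X hX
  simp [Measure.restrict_apply hX]

/-- A Borel set of full Lebesgue measure which is null for the singular part of `Ω`. -/
def acCarrier (Ω : MatrixMeasure n) : Set ℝ :=
  (Measure.mutuallySingular_singularPart Ω.trace volume).nullSet

lemma measurableSet_acCarrier (Ω : MatrixMeasure n) : MeasurableSet Ω.acCarrier :=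
  Measure.MutuallySingular.measurableSet_nullSet _

/-- The absolutely continuous part `Ω_ac` in the Lebesgue decomposition `Ω = Ω_ac + Ω_s` with
respect to Lebesgue measure; the singular part is the restriction of `Ω` to the complement of
`acCarrier`. See `acPart_absolutelyContinuous` and `singular_restrict_compl`. -/
def acPart (Ω : MatrixMeasure n) : MatrixMeasure n :=
  Ω.restrict Ω.acCarrier Ω.measurableSet_acCarrier

lemma acPart_absolutelyContinuous (Ω : MatrixMeasure n) : Ω.acPart.trace ≪ volume := by
  rw [acPart, trace_restrict]
  conv_lhs => rw [Ω.trace.haveLebesgueDecomposition_add volume]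
  rw [Measure.restrict_add, acCarrier, Measure.MutuallySingular.restrict_nullSet, zero_add]
  exact Measure.restrict_le_self.absolutelyContinuous.trans
    (withDensity_absolutelyContinuous _ _)

lemma singular_restrict_compl (Ω : MatrixMeasure n) :
    (Ω.restrict Ω.acCarrierᶜ Ω.measurableSet_acCarrier.compl).trace ⟂ₘ volume := by
  rw [trace_restrict]
  refine ⟨Ω.acCarrier, Ω.measurableSet_acCarrier, ?_, ?_⟩
  · rw [Measure.restrict_apply Ω.measurableSet_acCarrier]
    simp
  · exact Measure.MutuallySingular.measure_compl_nullSet _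

/-- `S` is a support of `Ω`: `Ω` vanishes on the complement of `S`. -/
def IsSupport (Ω : MatrixMeasure n) (S : Set ℝ) : Prop := Ω.trace Sᶜ = 0

/-- `S` is a support of `Ω` which is minimal relative to Lebesgue measure. -/
def IsMinimalSupport (Ω : MatrixMeasure n) (S : Set ℝ) : Prop :=
  Ω.IsSupport S ∧ ∀ T ⊆ S, Ω.IsSupport T → volume (S \ T) = 0

/-- The relation `S ∼ T`: the symmetric difference is null for `Ω` and for Lebesgue measure. -/
def SetEquiv (Ω : MatrixMeasure n) (S T : Set ℝ) : Prop :=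
  Ω.trace (symmDiff S T) = 0 ∧ volume (symmDiff S T) = 0

/-- Equivalence `Ω ∼ Ω'` of matrix measures: they have the same null sets. -/
def Equivalent (Ω Ω' : MatrixMeasure n) : Prop :=
  Ω.trace ≪ Ω'.trace ∧ Ω'.trace ≪ Ω.trace

/-- The set of atoms of `Ω`. -/
def atoms (Ω : MatrixMeasure n) : Set ℝ := {t | Ω.toFun {t} ≠ 0}

/-- `Ω` is a discrete point measure: it is carried by its set of atoms (pure point), and this set
has no finite accumulation point. The zero measure is included. -/
def IsDiscretePoint (Ω : MatrixMeasure n) : Prop :=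
  Ω.IsSupport Ω.atoms ∧ ∀ t : ℝ, ¬ AccPt t (𝓟 Ω.atoms)

end MatrixMeasure

namespace HerglotzMatrix

variable {n : ℕ}

/-- `Im M = (M - M*) / (2i)`. -/
def imPart (M : Matrix (Fin n) (Fin n) ℂ) : Matrix (Fin n) (Fin n) ℂ :=
  (1 / (2 * Complex.I)) • (M - M.conjTranspose)

/-- Herglotz matrices. Functions on the open upper half-plane are represented by functions on `ℂ`
whose values outside the open upper half-plane are never used. -/
def IsHerglotz (M : ℂ → Matrix (Fin n) (Fin n) ℂ) : Prop :=
  (∀ j k, DifferentiableOn ℂ (fun z => M z j k) {z : ℂ | 0 < z.im}) ∧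
    ∀ z : ℂ, 0 < z.im → (imPart (M z)).PosSemidef

/-- `Ω` is the measure in the Nevanlinna (Riesz-Herglotz) representation
`M(z) = C + D z + ∫ dΩ(t) ((t - z)⁻¹ - t (1 + t²)⁻¹)`, `C = C*`, `D ≥ 0`,
`∫ (x, dΩ(t) x) (1 + t²)⁻¹ < ∞`. The matrix identity is expressed through its quadratic forms,
which determine it by polarization. -/
def IsHerglotzMeasure (M : ℂ → Matrix (Fin n) (Fin n) ℂ) (Ω : MatrixMeasure n) : Prop :=
  (∀ x : Fin n → ℂ, Integrable (fun t : ℝ => (1 + t ^ 2)⁻¹) (Ω.quadMeasure x)) ∧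
  ∃ C D : Matrix (Fin n) (Fin n) ℂ, C.IsHermitian ∧ D.PosSemidef ∧
    ∀ z : ℂ, 0 < z.im → ∀ x : Fin n → ℂ,
      star x ⬝ᵥ ((M z).mulVec x) =
        star x ⬝ᵥ (C.mulVec x) + z * (star x ⬝ᵥ (D.mulVec x)) +
          ∫ t : ℝ, (((t : ℂ) - z)⁻¹ - (t : ℂ) * (1 + (t : ℂ) ^ 2)⁻¹) ∂(Ω.quadMeasure x)

/-- `M(t + i0) = L`. -/
def HasBoundaryValue (M : ℂ → Matrix (Fin n) (Fin n) ℂ) (t : ℝ)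
    (L : Matrix (Fin n) (Fin n) ℂ) : Prop :=
  Tendsto (fun ε : ℝ => M ((t : ℂ) + (ε : ℂ) * Complex.I)) (𝓝[>] 0) (𝓝 L)

/-- `S_{Ω_ac, r}`: the points where `M(t + i0)` exists finitely and `Im M(t + i0)` has rank `r`. -/
def acSet (M : ℂ → Matrix (Fin n) (Fin n) ℂ) (r : ℕ) : Set ℝ :=
  {t | ∃ L, HasBoundaryValue M t L ∧ (imPart L).rank = r}

/-- `S_{Ω_ac}`, the union of the sets `S_{Ω_ac, r}` with `1 ≤ r ≤ n`. -/
def acSupport (M : ℂ → Matrix (Fin n) (Fin n) ℂ) : Set ℝ :=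
  ⋃ r ∈ Set.Icc 1 n, acSet M r

/-- `ℰ_r(Ω_ac)`: the equivalence class of `S_{Ω_ac, r}`. -/
def acClassRank (M : ℂ → Matrix (Fin n) (Fin n) ℂ) (Ω : MatrixMeasure n) (r : ℕ) :
    Set (Set ℝ) :=
  {T | Ω.acPart.SetEquiv T (acSet M r)}

/-- `ℰ(Ω_ac)`: the equivalence class of `S_{Ω_ac}`. -/
def acClass (M : ℂ → Matrix (Fin n) (Fin n) ℂ) (Ω : MatrixMeasure n) : Set (Set ℝ) :=
  {T | Ω.acPart.SetEquiv T (acSupport M)}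

/-- `𝒜_{2n}`, the matrices with `A* J A = J`, where `J` has the blocks `0, -1, 1, 0`. -/
def JUnitary (n : ℕ) : Set (Matrix (Fin n ⊕ Fin n) (Fin n ⊕ Fin n) ℂ) :=
  {A | A.conjTranspose * Matrix.J (Fin n) ℂ * A = Matrix.J (Fin n) ℂ}

/-- `A ∈ 𝒜_{2n}` and `ker (A₁₁ + A₁₂ M(z)) = {0}` for all `z` in the open upper half-plane. -/
def Admissible (M : ℂ → Matrix (Fin n) (Fin n) ℂ)
    (A : Matrix (Fin n ⊕ Fin n) (Fin n ⊕ Fin n) ℂ) : Prop :=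
  A ∈ JUnitary n ∧ ∀ z : ℂ, 0 < z.im →
    ∀ v : Fin n → ℂ, (A.toBlocks₁₁ + A.toBlocks₁₂ * M z).mulVec v = 0 → v = 0

/-- `M_A(z) = (A₂₁ + A₂₂ M(z)) (A₁₁ + A₁₂ M(z))⁻¹`. -/
def transform (A : Matrix (Fin n ⊕ Fin n) (Fin n ⊕ Fin n) ℂ)
    (M : ℂ → Matrix (Fin n) (Fin n) ℂ) : ℂ → Matrix (Fin n) (Fin n) ℂ :=
  fun z => (A.toBlocks₂₁ + A.toBlocks₂₂ * M z) * (A.toBlocks₁₁ + A.toBlocks₁₂ * M z)⁻¹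

/-- The set of `t ∈ ℝ` for which there is no (admissible) `A ∈ 𝒜_{2n}` such that
`Im M_A(t + i0)` exists and equals `0`. -/
def exceptionalSet (M : ℂ → Matrix (Fin n) (Fin n) ℂ) : Set ℝ :=
  {t | ¬ ∃ A, Admissible M A ∧
    Tendsto (fun ε : ℝ => imPart (transform A M ((t : ℂ) + (ε : ℂ) * Complex.I)))
      (𝓝[>] 0) (𝓝 0)}

end HerglotzMatrix

end

/-!
The main point is the boundary behaviour of a Nevanlinna function
`f(z) = c + d z + ∫ ((t - z)⁻¹ - t (1 + t²)⁻¹) dμ(t)`.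

* A finite limit `f(t + i0)` exists for almost every `t`
  (`ae_exists_tendsto_vertical_of_im_nonneg`). The function `q = 1 / (1 - i f)` is bounded, its
  primitive extends to a Lipschitz function on the real line, and Poisson's formula, integrated by
  parts, shows that `q` has a vertical limit wherever that function is differentiable. The limit of
  `q` is almost everywhere nonzero (`ae_not_tendsto_vertical_zero`).
* For almost every `t`, `Im f(t + i0) = 0` exactly if the density of `μ` with respect to Lebesgue
  measure vanishes at `t` (`ae_tendsto_im_nevanlinna_eq_zero_iff`), and `μ` does not charge the set
  where `Im f(t + i0) = 0` (`ae_not_tendsto_im_nevanlinna_zero`). Both follow from the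
  differentiation of measures along small intervals.

For a Herglotz matrix `M` these facts are applied to the quadratic forms, which determine `M` by
polarization, and to the trace; a nonnegative matrix vanishes when its trace does. So `M(t + i0)`
exists almost everywhere and `S_{Ω_ac}` is, up to a Lebesgue null set, the set where the density of
`tr Ω` is nonzero. These sets are the minimal supports of `Ω_ac`, and the class of a set for `Ω_ac`
is its class modulo Lebesgue null sets.

If `Y` is the transform of `X` by a `J`-unitary `A` and `N = A₁₁ + A₁₂ X`, then
`N* (Im Y) N = Im X`, and `N` is invertible wherever `Y` is finite
(`conjTranspose_mul_imPart_mul`, `isUnit_det_denominator`). Passing to boundary values, the ranks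
of `Im M(t + i0)` and `Im M_A(t + i0)` agree wherever both limits exist, which gives the invariance
of the classes. The same identity shows that if `M(t + i0)` exists and has nonzero imaginary part,
then no transform has imaginary part tending to zero at `t`; if the imaginary part of `M(t + i0)`
is zero, the transform by the identity does. Hence the exceptional set agrees with `S_{Ω_ac}`
almost everywhere, although it is defined by a condition on all admissible `A`.

Discreteness of `Ω_B` means that `M_B` continues meromorphically to a neighbourhood of every real
point, with Hermitian values on a punctured real neighbourhood. As `M_A` is a linear fractional
transform of `M_B` whose denominator is meromorphic and not identically zero, the imaginary part of
`M_A` has limit zero at all real points near the given one, so `Ω_A` does not charge them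
(`isDiscretePoint_of_linearFractional`).
-/

/-! ### Bounded analytic functions in the upper half-plane -/

/-- Poisson's formula at height one for a bounded analytic function on a half-plane containing the
closed upper half-plane. The quotient `(g w - g I) / (w ^ 2 + 1)` is analytic in the closed upper
half-plane, so its integral over the boundary of a large rectangle vanishes, and the three sides
off the real axis do not contribute in the limit. -/
lemma integral_inv_one_add_sq_smul_of_bounded {g : ℂ → ℂ} {δ C : ℝ} (hδ : 0 < δ)
    (hg : DifferentiableOn ℂ g {z | -δ < z.im}) (hb : ∀ z : ℂ, -δ < z.im → ‖g z‖ ≤ C) :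
    ∫ u : ℝ, (1 + u ^ 2)⁻¹ • g u = Real.pi • g Complex.I := by
  have hC : 0 ≤ C := (norm_nonneg _).trans (hb Complex.I (by simp; linarith))
  have hopen : IsOpen {z : ℂ | -δ < z.im} := isOpen_lt continuous_const Complex.continuous_im
  have hcont : Continuous fun u : ℝ => g u := by
    refine continuous_iff_continuousAt.2 fun u => ?_
    have h1 : ContinuousAt g (u : ℂ) :=
      (hg.differentiableAt (hopen.mem_nhds (by simpa using hδ))).continuousAt
    exact ContinuousAt.comp (f := fun u : ℝ => (u : ℂ)) h1 Complex.continuous_ofReal.continuousAt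
  have hint1 : Integrable fun u : ℝ => (1 + u ^ 2)⁻¹ • g u := by
    refine (integrable_inv_one_add_sq.mul_const C).mono'
      (by exact AEStronglyMeasurable.smul
            integrable_inv_one_add_sq.aestronglyMeasurable hcont.aestronglyMeasurable)
      (ae_of_all _ fun u => ?_)
    have : 0 ≤ (1 + u ^ 2)⁻¹ := by positivity
    rw [norm_smul, Real.norm_of_nonneg this]
    exact mul_le_mul_of_nonneg_left (hb _ (by simpa using hδ)) this
  have hint2 : Integrable fun u : ℝ => (1 + u ^ 2)⁻¹ • g Complex.I :=
    integrable_inv_one_add_sq.smul_const _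
  set G : ℂ → ℂ := fun w => dslope g Complex.I w * (w + Complex.I)⁻¹ with hG
  have hGeq : ∀ w : ℂ, w ≠ Complex.I → w ≠ -Complex.I →
      G w = (w ^ 2 + 1)⁻¹ * (g w - g Complex.I) := by
    intro w h1 h2
    have e : w ^ 2 + 1 = (w - Complex.I) * (w + Complex.I) := by
      linear_combination Complex.I_sq
    have h3 : w + Complex.I ≠ 0 := fun h => h2 (eq_neg_of_add_eq_zero_left h)
    simp only [hG, dslope_of_ne g h1, slope, vsub_eq_sub, smul_eq_mul]
    rw [e, mul_inv]; ring
  have hreal : ∀ u : ℝ, G u = (1 + u ^ 2)⁻¹ • g u - (1 + u ^ 2)⁻¹ • g Complex.I := by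
    intro u
    rw [hGeq _ (fun h => by simpa using congrArg Complex.im h)
      (fun h => by simpa using congrArg Complex.im h), ← smul_sub, Complex.real_smul]
    push_cast
    ring
  have hGint : Integrable fun u : ℝ => G u := by
    simp_rw [hreal]; exact hint1.sub hint2
  have hrect : ∀ R : ℝ, 0 < R →
      (∫ x : ℝ in -R..R, G x) = (∫ x : ℝ in -R..R, G (x + R * Complex.I)) -
        Complex.I • (∫ y : ℝ in 0..R, G (R + y * Complex.I)) +
        Complex.I • (∫ y : ℝ in 0..R, G (-R + y * Complex.I)) := by
    intro R hR
    have h := Complex.integral_boundary_rect_eq_zero_of_differentiableOn G (-R : ℂ)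
      (R + R * Complex.I) ?_
    · simp at h ⊢
      linear_combination h
    · have hsub : (Set.uIcc (-R : ℂ).re ((R : ℂ) + R * Complex.I).re ×ℂ
          Set.uIcc (-R : ℂ).im ((R : ℂ) + R * Complex.I).im) ⊆ {z : ℂ | 0 ≤ z.im} := by
        intro z hz
        have := hz.2
        simp [Set.uIcc_of_le hR.le] at this
        exact this.1
      have hd : DifferentiableOn ℂ (dslope g Complex.I) {z | -δ < z.im} :=
        (Complex.differentiableOn_dslope (hopen.mem_nhds (by simp; linarith))).2 hg
      refine DifferentiableOn.mul (hd.mono fun z hz => ?_) fun z hz => ?_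
      · have := hsub hz; simp only [Set.mem_ofPred_eq] at this ⊢; linarith
      · have h1 := hsub hz
        simp only [Set.mem_ofPred_eq] at h1
        refine (DifferentiableAt.inv (by fun_prop) fun h => ?_).differentiableWithinAt
        have := congrArg Complex.im h
        simp at this
        linarith
  have hbound : ∀ R : ℝ, 2 ≤ R → ∀ w : ℂ, 0 ≤ w.im → R ≤ ‖w‖ → ‖G w‖ ≤ 4 * C / R ^ 2 := by
    intro R hR w hw hRw
    have hne : ∀ v : ℂ, ‖v‖ = 1 → w ≠ v := by
      intro v hv h; rw [h, hv] at hRw; linarith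
    rw [hGeq w (hne _ (by simp)) (hne _ (by simp)), norm_mul, norm_inv]
    have h1 : R ^ 2 / 2 ≤ ‖w ^ 2 + 1‖ := by
      have h2 : ‖w‖ ^ 2 - 1 ≤ ‖w ^ 2 + 1‖ := by
        have := norm_sub_le (w ^ 2 + 1) 1
        simp at this
        linarith
      nlinarith [norm_nonneg w]
    have h3 : ‖g w - g Complex.I‖ ≤ 2 * C := by
      have := norm_sub_le (g w) (g Complex.I)
      have h4 := hb w (by linarith)
      have h5 := hb Complex.I (by simp; linarith)
      linarith
    calc ‖w ^ 2 + 1‖⁻¹ * ‖g w - g Complex.I‖ ≤ (R ^ 2 / 2)⁻¹ * (2 * C) := by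
          gcongr
      _ = 4 * C / R ^ 2 := by field_simp; ring
  have hlim : Tendsto (fun R : ℝ => ∫ x : ℝ in -R..R, G x) atTop (𝓝 0) := by
    refine squeeze_zero_norm' (a := fun R : ℝ => 16 * C / R) ?_ ?_
    · filter_upwards [eventually_ge_atTop (2 : ℝ)] with R hR
      have hR0 : 0 < R := by linarith
      have n1 : ‖∫ x : ℝ in -R..R, G (x + R * Complex.I)‖ ≤ 4 * C / R ^ 2 * |R - -R| := by
        refine intervalIntegral.norm_integral_le_of_norm_le_const fun x _ =>
          hbound R hR _ (by simpa using hR0.le) ?_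
        have := Complex.abs_im_le_norm ((x : ℂ) + R * Complex.I)
        simp [abs_of_pos hR0] at this
        exact this
      have n2 : ‖∫ y : ℝ in 0..R, G (R + y * Complex.I)‖ ≤ 4 * C / R ^ 2 * |R - 0| := by
        refine intervalIntegral.norm_integral_le_of_norm_le_const fun x hx =>
          hbound R hR _ ?_ ?_
        · rw [Set.uIoc_of_le hR0.le] at hx; simpa using hx.1.le
        have := Complex.abs_re_le_norm ((R : ℂ) + x * Complex.I)
        simp [abs_of_pos hR0] at this
        exact this
      have n3 : ‖∫ y : ℝ in 0..R, G (-R + y * Complex.I)‖ ≤ 4 * C / R ^ 2 * |R - 0| := by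
        refine intervalIntegral.norm_integral_le_of_norm_le_const fun x hx =>
          hbound R hR _ ?_ ?_
        · rw [Set.uIoc_of_le hR0.le] at hx; simpa using hx.1.le
        have := Complex.abs_re_le_norm (-(R : ℂ) + x * Complex.I)
        simp [abs_of_pos hR0] at this
        exact this
      rw [hrect R hR0]
      refine (norm_add_le _ _).trans ((add_le_add_left (norm_sub_le _ _) _).trans ?_)
      rw [norm_smul, norm_smul, Complex.norm_I, one_mul, one_mul]
      have e1 : |R - -R| = 2 * R := by rw [abs_of_pos] <;> linarith
      have e2 : |R - 0| = R := by rw [abs_of_pos] <;> linarith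
      rw [e1] at n1; rw [e2] at n2 n3
      refine (add_le_add (add_le_add n1 n2) n3).trans (le_of_eq ?_)
      field_simp
      ring
    · exact tendsto_const_nhds.div_atTop tendsto_id
  have hlim2 := intervalIntegral_tendsto_integral hGint tendsto_neg_atTop_atBot tendsto_id
  have h0 := tendsto_nhds_unique hlim2 hlim
  simp_rw [hreal] at h0
  rw [integral_sub hint1 hint2, integral_smul_const, integral_univ_inv_one_add_sq] at h0
  exact sub_eq_zero.1 h0

/-- Poisson's formula for a bounded analytic function `h` on the upper half-plane, with the base
line lifted to height `δ`, in the variable that scales the height above this line to one. -/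
lemma integral_inv_one_add_sq_smul_vertical {h : ℂ → ℂ} {C : ℝ}
    (hd : DifferentiableOn ℂ h {z | 0 < z.im}) (hb : ∀ z : ℂ, 0 < z.im → ‖h z‖ ≤ C)
    (t : ℝ) {δ y : ℝ} (hδ : 0 < δ) (hy : 0 < y) :
    ∫ u : ℝ, (1 + u ^ 2)⁻¹ • h (((t + y * u : ℝ) : ℂ) + δ * Complex.I) =
      Real.pi • h (t + ((δ + y : ℝ) : ℂ) * Complex.I) := by
  have hm : ∀ z : ℂ, -(δ / y) < z.im → 0 < ((t : ℂ) + y * z + δ * Complex.I).im := by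
    intro z hz
    simp
    rw [← neg_div, div_lt_iff₀ hy] at hz
    nlinarith
  have := integral_inv_one_add_sq_smul_of_bounded (g := fun w => h (t + y * w + δ * Complex.I))
    (δ := δ / y) (C := C) (by positivity)
    (hd.comp (by fun_prop) fun z hz => hm z hz) fun z hz => hb _ (hm z hz)
  convert this using 3
  · push_cast; rfl
  · push_cast; ring

lemma continuous_horizontal {h : ℂ → ℂ} (hd : DifferentiableOn ℂ h {z | 0 < z.im})
    {δ : ℝ} (hδ : 0 < δ) : Continuous fun s : ℝ => h (s + δ * Complex.I) := by
  refine continuous_iff_continuousAt.2 fun s => ?_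
  have hopen : IsOpen {z : ℂ | 0 < z.im} := isOpen_lt continuous_const Complex.continuous_im
  have h1 : ContinuousAt h ((s : ℂ) + δ * Complex.I) :=
    (hd.differentiableAt (hopen.mem_nhds (by simpa using hδ))).continuousAt
  exact ContinuousAt.comp (f := fun s : ℝ => (s : ℂ) + δ * Complex.I) h1 (by fun_prop)

/-- The primitives of a bounded analytic function along two horizontal lines differ by at most a
multiple of the distance of the lines. -/
lemma norm_primitive_sub_primitive_le {h : ℂ → ℂ} {C : ℝ}
    (hd : DifferentiableOn ℂ h {z | 0 < z.im}) (hb : ∀ z : ℂ, 0 < z.im → ‖h z‖ ≤ C)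
    {δ η : ℝ} (hδ : 0 < δ) (hη : 0 < η) (x : ℝ) :
    ‖(∫ s in 0..x, h (s + δ * Complex.I)) - ∫ s in 0..x, h (s + η * Complex.I)‖ ≤
      2 * C * |η - δ| := by
  have hu : ∀ y ∈ Set.uIcc δ η, 0 < y := fun y hy => (lt_min hδ hη).trans_le hy.1
  have key := Complex.integral_boundary_rect_eq_zero_of_differentiableOn h (δ * Complex.I)
    (x + η * Complex.I) (hd.mono fun z hz => hu _ (by simpa using hz.2))
  simp at key
  have e : (∫ s in 0..x, h (s + δ * Complex.I)) - ∫ s in 0..x, h (s + η * Complex.I) =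
      Complex.I * (∫ y in δ..η, h (y * Complex.I)) -
        Complex.I * ∫ y in δ..η, h (x + y * Complex.I) := by
    linear_combination key
  rw [e]
  refine (norm_sub_le _ _).trans ?_
  rw [norm_mul, norm_mul, Complex.norm_I, one_mul, one_mul, two_mul, add_mul]
  refine add_le_add ?_ ?_ <;>
  · refine intervalIntegral.norm_integral_le_of_norm_le_const fun y hy => hb _ ?_
    simpa using hu _ (Set.uIoc_subset_uIcc hy)

lemma hasDerivAt_inv_one_add_sq (u : ℝ) :
    HasDerivAt (fun u : ℝ => (1 + u ^ 2)⁻¹) (-(2 * u) / (1 + u ^ 2) ^ 2) u := by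
  have := ((hasDerivAt_pow 2 u).const_add 1).inv (by positivity)
  simp only [Nat.cast_ofNat, Nat.add_one_sub_one, pow_one] at this
  exact this

lemma integrable_two_mul_abs_div_mul_abs :
    Integrable fun u : ℝ => 2 * |u| / (1 + u ^ 2) ^ 2 * |u| := by
  refine (integrable_inv_one_add_sq.const_mul 2).mono'
    (by fun_prop (disch := intros; positivity)) (ae_of_all _ fun u => ?_)
  rw [Real.norm_of_nonneg (by positivity)]
  have e : 2 * |u| / (1 + u ^ 2) ^ 2 * |u| = 2 * u ^ 2 / (1 + u ^ 2) ^ 2 := by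
    rw [← sq_abs u]; ring
  rw [e, ← div_eq_mul_inv, div_le_div_iff₀ (by positivity) (by positivity)]
  nlinarith [sq_nonneg u]

/-- Poisson's formula after an integration by parts, which moves the derivative from the primitive
`H` of a bounded continuous function to the Poisson kernel. -/
lemma integral_inv_one_add_sq_mul_eq_primitive {φ : ℝ → ℂ} (hφ : Continuous φ) {C : ℝ}
    (hb : ∀ s, ‖φ s‖ ≤ C) (t : ℝ) {y : ℝ} (hy : 0 < y) :
    ∫ u : ℝ, (1 + u ^ 2)⁻¹ • φ (t + y * u) =
      ∫ u : ℝ, (2 * u / (1 + u ^ 2) ^ 2) •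
        (y⁻¹ • ((∫ s in 0..(t + y * u), φ s) - ∫ s in 0..t, φ s)) := by
  have hC : 0 ≤ C := (norm_nonneg _).trans (hb 0)
  set v : ℝ → ℂ := fun u => y⁻¹ • ((∫ s in 0..(t + y * u), φ s) - ∫ s in 0..t, φ s) with hv
  have hvle : ∀ u, ‖v u‖ ≤ C * |u| := by
    intro u
    simp only [hv]
    rw [intervalIntegral.integral_interval_sub_left (hφ.intervalIntegrable _ _)
      (hφ.intervalIntegrable _ _), norm_smul, norm_inv, Real.norm_of_nonneg hy.le]
    have := intervalIntegral.norm_integral_le_of_norm_le_const (a := t) (b := t + y * u)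
      (f := φ) (C := C) fun s _ => hb s
    rw [add_sub_cancel_left, abs_mul, abs_of_pos hy] at this
    rw [inv_mul_le_iff₀ hy]
    linarith
  have hvd : ∀ u, HasDerivAt v (φ (t + y * u)) u := by
    intro u
    have h1 : HasDerivAt (fun x => ∫ s in 0..x, φ s) (φ (t + y * u)) (t + y * u) :=
      intervalIntegral.integral_hasDerivAt_right (hφ.intervalIntegrable _ _)
        hφ.aestronglyMeasurable.stronglyMeasurableAtFilter hφ.continuousAt
    have h2 : HasDerivAt (fun u : ℝ => t + y * u) y u := by
      simpa using ((hasDerivAt_id u).const_mul y).const_add t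
    have h3 := ((h1.scomp u h2).sub_const (∫ s in 0..t, φ s)).const_smul y⁻¹
    rwa [smul_smul, inv_mul_cancel₀ hy.ne', one_smul] at h3
  have hvc : Continuous v := continuous_iff_continuousAt.2 fun u => (hvd u).continuousAt
  have hk : ∀ u : ℝ, HasDerivAt (fun u : ℝ => (((1 + u ^ 2)⁻¹ : ℝ) : ℂ))
      ((-(2 * u) / (1 + u ^ 2) ^ 2 : ℝ) : ℂ) u := fun u =>
    (hasDerivAt_inv_one_add_sq u).ofReal_comp
  have hint1 : Integrable ((fun u : ℝ => (((1 + u ^ 2)⁻¹ : ℝ) : ℂ)) *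
      fun u => φ (t + y * u)) := by
    refine (integrable_inv_one_add_sq.mul_const C).mono' ?_ (ae_of_all _ fun u => ?_)
    · exact (Continuous.mul (Complex.continuous_ofReal.comp
        (by fun_prop (disch := intros; positivity))) (by fun_prop)).aestronglyMeasurable
    · have : 0 ≤ (1 + u ^ 2)⁻¹ := by positivity
      rw [Pi.mul_apply, norm_mul, Complex.norm_real, Real.norm_of_nonneg this]
      exact mul_le_mul_of_nonneg_left (hb _) this
  have hint2 : Integrable ((fun u : ℝ => ((-(2 * u) / (1 + u ^ 2) ^ 2 : ℝ) : ℂ)) * v) := by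
    refine (integrable_two_mul_abs_div_mul_abs.mul_const C).mono' ?_ (ae_of_all _ fun u => ?_)
    · exact (Continuous.mul (Complex.continuous_ofReal.comp
        (by fun_prop (disch := intros; positivity))) hvc).aestronglyMeasurable
    · rw [Pi.mul_apply, norm_mul, Complex.norm_real, norm_div, norm_neg, norm_mul,
        Real.norm_of_nonneg (by positivity : (0 : ℝ) ≤ (1 + u ^ 2) ^ 2), Real.norm_eq_abs,
        Real.norm_eq_abs, abs_two, mul_assoc]
      exact mul_le_mul_of_nonneg_left ((hvle u).trans_eq (mul_comm _ _)) (by positivity)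
  have hdecay : ∀ u : ℝ, 0 < |u| →
      ‖((fun u : ℝ => (((1 + u ^ 2)⁻¹ : ℝ) : ℂ)) * v) u‖ ≤ C / |u| := by
    intro u hu
    rw [Pi.mul_apply, norm_mul, Complex.norm_real, Real.norm_of_nonneg (by positivity)]
    refine (mul_le_mul_of_nonneg_left (hvle u) (by positivity)).trans ?_
    rw [inv_mul_eq_div, div_le_div_iff₀ (by positivity) hu, mul_assoc, abs_mul_abs_self]
    nlinarith [sq_nonneg u]
  have htop : Tendsto ((fun u : ℝ => (((1 + u ^ 2)⁻¹ : ℝ) : ℂ)) * v) atTop (𝓝 0) := by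
    refine squeeze_zero_norm' (a := fun u => C / |u|) ?_
      (tendsto_const_nhds.div_atTop tendsto_abs_atTop_atTop)
    · filter_upwards [eventually_gt_atTop 0] with u hu using hdecay u (abs_pos.2 hu.ne')
  have hbot : Tendsto ((fun u : ℝ => (((1 + u ^ 2)⁻¹ : ℝ) : ℂ)) * v) atBot (𝓝 0) := by
    refine squeeze_zero_norm' (a := fun u => C / |u|) ?_
      (tendsto_const_nhds.div_atTop tendsto_abs_atBot_atTop)
    · filter_upwards [eventually_lt_atBot 0] with u hu using hdecay u (abs_pos.2 hu.ne)
  have := integral_mul_deriv_eq_deriv_mul (fun u _ => hk u) (fun u _ => hvd u) hint1 hint2 hbot htop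
  simp only [sub_zero, zero_sub, ← Complex.real_smul] at this
  rw [this, ← integral_neg]
  refine integral_congr_ae (ae_of_all _ fun u => ?_)
  simp only [neg_div, neg_smul, neg_neg, hv]

/-- Fatou's theorem along vertical lines: a bounded analytic function on the upper half-plane has
a vertical limit at almost every point of the real line. The limit is the derivative of the
Lipschitz function which is the boundary value of the primitive. -/
lemma ae_exists_tendsto_vertical_of_bounded {h : ℂ → ℂ} {C : ℝ}
    (hd : DifferentiableOn ℂ h {z | 0 < z.im}) (hb : ∀ z : ℂ, 0 < z.im → ‖h z‖ ≤ C) :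
    ∀ᵐ t : ℝ, ∃ ℓ : ℂ, Tendsto (fun ε : ℝ => h (t + ε * Complex.I)) (𝓝[>] 0) (𝓝 ℓ) := by
  have hC : 0 ≤ C := (norm_nonneg _).trans (hb Complex.I (by simp))
  set H : ℝ → ℝ → ℂ := fun δ x => ∫ s in 0..x, h (s + δ * Complex.I) with hH
  have hφ : ∀ {δ : ℝ}, 0 < δ → Continuous fun s : ℝ => h (s + δ * Complex.I) :=
    fun hδ => continuous_horizontal hd hδ
  set d : ℕ → ℝ := fun n => 1 / ((n : ℝ) + 1) with hdd
  have hd0 : ∀ n, 0 < d n := fun n => by positivity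
  have hdt : Tendsto d atTop (𝓝 0) := tendsto_one_div_add_atTop_nhds_zero_nat
  have hlim : ∀ x, ∃ L, Tendsto (fun n => H (d n) x) atTop (𝓝 L) := by
    intro x
    refine cauchySeq_tendsto_of_complete ?_
    have hcd : CauchySeq d := hdt.cauchySeq
    rw [Metric.cauchySeq_iff'] at hcd ⊢
    intro ε hε
    obtain ⟨N, hN⟩ := hcd (ε / (2 * C + 1)) (by positivity)
    refine ⟨N, fun n hn => ?_⟩
    have h1 := hN n hn
    rw [dist_comm, Real.dist_eq, lt_div_iff₀ (by positivity)] at h1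
    rw [dist_eq_norm]
    refine (norm_primitive_sub_primitive_le hd hb (hd0 n) (hd0 N) x).trans_lt ?_
    nlinarith [abs_nonneg (d N - d n)]
  choose H0 hH0 using hlim
  have hHlip : ∀ {δ : ℝ}, 0 < δ → ∀ x x', ‖H δ x - H δ x'‖ ≤ C * |x - x'| := by
    intro δ hδ x x'
    simp only [hH]
    rw [intervalIntegral.integral_interval_sub_left ((hφ hδ).intervalIntegrable _ _)
      ((hφ hδ).intervalIntegrable _ _)]
    exact intervalIntegral.norm_integral_le_of_norm_le_const fun s _ => hb _ (by simpa using hδ)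
  have hlip' : ∀ x x', ‖H0 x - H0 x'‖ ≤ C * |x - x'| := fun x x' =>
    le_of_tendsto ((hH0 x).sub (hH0 x')).norm (Eventually.of_forall fun n => hHlip (hd0 n) x x')
  have hlip : LipschitzWith ⟨C, hC⟩ H0 := LipschitzWith.of_dist_le_mul fun x x' => by
    rw [dist_eq_norm, Real.dist_eq]; exact hlip' x x'
  have hopen : IsOpen {z : ℂ | 0 < z.im} := isOpen_lt continuous_const Complex.continuous_im
  have hdom : ∀ (t y u : ℝ), 0 < y → ∀ F : ℝ → ℂ, (∀ x x', ‖F x - F x'‖ ≤ C * |x - x'|) →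
      ‖(2 * u / (1 + u ^ 2) ^ 2) • (y⁻¹ • (F (t + y * u) - F t))‖ ≤
        2 * |u| / (1 + u ^ 2) ^ 2 * |u| * C := by
    intro t y u hy F hF
    have h1 : ‖y⁻¹ • (F (t + y * u) - F t)‖ ≤ |u| * C := by
      rw [norm_smul, norm_inv, Real.norm_of_nonneg hy.le, inv_mul_le_iff₀ hy]
      refine (hF _ _).trans (le_of_eq ?_)
      rw [add_sub_cancel_left, abs_mul, abs_of_pos hy]; ring
    rw [norm_smul, norm_div, norm_mul, Real.norm_eq_abs, abs_two,
      Real.norm_of_nonneg (by positivity : (0 : ℝ) ≤ (1 + u ^ 2) ^ 2), Real.norm_eq_abs, mul_assoc]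
    exact mul_le_mul_of_nonneg_left h1 (by positivity)
  have hrep : ∀ t y : ℝ, 0 < y → Real.pi • h (t + y * Complex.I) =
      ∫ u : ℝ, (2 * u / (1 + u ^ 2) ^ 2) • (y⁻¹ • (H0 (t + y * u) - H0 t)) := by
    intro t y hy
    have hn : ∀ n, Real.pi • h (t + ((d n + y : ℝ) : ℂ) * Complex.I) =
        ∫ u : ℝ, (2 * u / (1 + u ^ 2) ^ 2) • (y⁻¹ • (H (d n) (t + y * u) - H (d n) t)) := by
      intro n
      rw [← integral_inv_one_add_sq_smul_vertical hd hb t (hd0 n) hy]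
      exact integral_inv_one_add_sq_mul_eq_primitive (hφ (hd0 n))
        (fun s => hb _ (by simpa using hd0 n)) t hy
    have hl : Tendsto (fun n => Real.pi • h (t + ((d n + y : ℝ) : ℂ) * Complex.I)) atTop
        (𝓝 (Real.pi • h (t + y * Complex.I))) := by
      have hc : ContinuousAt h ((t : ℂ) + y * Complex.I) :=
        (hd.differentiableAt (hopen.mem_nhds (by simpa using hy))).continuousAt
      refine (hc.tendsto.comp ?_).const_smul _
      have : Tendsto (fun n => d n + y) atTop (𝓝 y) := by simpa using hdt.add_const y
      exact (((Complex.continuous_ofReal.tendsto y).comp this).mul_const _).const_add _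
    simp_rw [hn] at hl
    refine tendsto_nhds_unique hl ?_
    refine tendsto_integral_of_dominated_convergence
      (fun u => 2 * |u| / (1 + u ^ 2) ^ 2 * |u| * C) (fun n => ?_)
      (integrable_two_mul_abs_div_mul_abs.mul_const C) (fun n => ae_of_all _ fun u => ?_)
      (ae_of_all _ fun u => ?_)
    · have hHc : Continuous (H (d n)) := (LipschitzWith.of_dist_le_mul (K := ⟨C, hC⟩)
        fun x x' => by rw [dist_eq_norm, Real.dist_eq]; exact hHlip (hd0 n) x x').continuous
      refine Continuous.aestronglyMeasurable (Continuous.fun_smul ?_ ?_)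
      · fun_prop (disch := intros; positivity)
      · fun_prop
    · exact hdom t y u hy _ (hHlip (hd0 n))
    · exact (((hH0 _).sub (hH0 _)).const_smul _).const_smul _
  filter_upwards [hlip.ae_differentiableAt_real] with t ht
  refine ⟨Real.pi⁻¹ • ∫ u : ℝ, (2 * u / (1 + u ^ 2) ^ 2) • (u • deriv H0 t), ?_⟩
  have hlim2 : Tendsto (fun y : ℝ =>
      ∫ u : ℝ, (2 * u / (1 + u ^ 2) ^ 2) • (y⁻¹ • (H0 (t + y * u) - H0 t))) (𝓝[>] 0)
      (𝓝 (∫ u : ℝ, (2 * u / (1 + u ^ 2) ^ 2) • (u • deriv H0 t))) := by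
    refine tendsto_integral_filter_of_dominated_convergence
      (fun u => 2 * |u| / (1 + u ^ 2) ^ 2 * |u| * C) (Eventually.of_forall fun y => ?_) ?_
      (integrable_two_mul_abs_div_mul_abs.mul_const C) (ae_of_all _ fun u => ?_)
    · have := hlip.continuous
      refine Continuous.aestronglyMeasurable (Continuous.fun_smul ?_ ?_)
      · fun_prop (disch := intros; positivity)
      · fun_prop
    · filter_upwards [self_mem_nhdsWithin] with y hy
      exact ae_of_all _ fun u => hdom t y u hy _ hlip'
    · refine Tendsto.const_smul ?_ _
      have h2 : HasDerivAt (fun y : ℝ => t + y * u) u 0 := by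
        simpa using ((hasDerivAt_id (0 : ℝ)).mul_const u).const_add t
      have h1 : HasDerivAt H0 (deriv H0 t) (t + 0 * u) := by simpa using ht.hasDerivAt
      have h3 := hasDerivAt_iff_tendsto_slope_zero.1 (h1.scomp 0 h2)
      simp only [zero_add, zero_mul, add_zero, Function.comp_apply] at h3
      exact h3.mono_left (nhdsWithin_mono _ fun y hy => ne_of_gt hy)
  refine (hlim2.const_smul Real.pi⁻¹).congr' ?_
  filter_upwards [self_mem_nhdsWithin] with y hy
  rw [← hrep t y hy, smul_smul, inv_mul_cancel₀ Real.pi_ne_zero, one_smul]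

/-- A bounded analytic function on the upper half-plane with positive real part has zero vertical
limit only on a null set. Poisson's formula bounds `|q(i)| ^ α` by the Poisson average of
`|q| ^ α` over the boundary; letting `α → 0`, the harmonic measure of the set where the boundary
value is nonzero is seen to be full. -/
lemma ae_not_tendsto_vertical_zero {q : ℂ → ℂ}
    (hd : DifferentiableOn ℂ q {z | 0 < z.im}) (hb : ∀ z : ℂ, 0 < z.im → ‖q z‖ ≤ 1)
    (hre : ∀ z : ℂ, 0 < z.im → 0 < (q z).re) :
    ∀ᵐ t : ℝ, ¬ Tendsto (fun ε : ℝ => q (t + ε * Complex.I)) (𝓝[>] 0) (𝓝 0) := by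
  obtain ⟨ℓ, hℓ⟩ := Filter.skolem.1 (ae_exists_tendsto_vertical_of_bounded hd hb)
  have hopen : IsOpen {z : ℂ | 0 < z.im} := isOpen_lt continuous_const Complex.continuous_im
  have hq0 : ∀ z : ℂ, 0 < z.im → q z ≠ 0 := fun z hz h => by
    have := hre z hz; rw [h] at this; simp at this
  set d : ℕ → ℝ := fun n => 1 / ((n : ℝ) + 1) with hdd
  have hd0 : ∀ n, 0 < d n := fun n => by positivity
  have hdt : Tendsto d atTop (𝓝 0) := tendsto_one_div_add_atTop_nhds_zero_nat
  have hdt' : Tendsto d atTop (𝓝[>] 0) :=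
    tendsto_nhdsWithin_iff.2 ⟨hdt, Eventually.of_forall hd0⟩
  have hL : ∀ᵐ u : ℝ, Tendsto (fun n => ‖q (u + d n * Complex.I)‖) atTop (𝓝 ‖ℓ u‖) := by
    filter_upwards [hℓ] with u hu using (hu.comp hdt').norm
  have hL1 : ∀ᵐ u : ℝ, ‖ℓ u‖ ≤ 1 := by
    filter_upwards [hL] with u hu
    exact le_of_tendsto hu (Eventually.of_forall fun n => hb _ (by simpa using hd0 n))
  have hqm : ∀ n, AEStronglyMeasurable (fun u : ℝ => ‖q (u + d n * Complex.I)‖) volume :=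
    fun n => (continuous_horizontal hd (hd0 n)).norm.aestronglyMeasurable
  have hLm : AEStronglyMeasurable (fun u => ‖ℓ u‖) volume :=
    aestronglyMeasurable_of_tendsto_ae atTop hqm hL
  have hkm : AEStronglyMeasurable (fun u : ℝ => (1 + u ^ 2)⁻¹) volume :=
    integrable_inv_one_add_sq.aestronglyMeasurable
  have hdomin : ∀ (u r : ℝ), 0 ≤ r → r ≤ 1 → ‖(1 + u ^ 2)⁻¹ * r‖ ≤ (1 + u ^ 2)⁻¹ := by
    intro u r h0 h1
    have : 0 ≤ (1 + u ^ 2)⁻¹ := by positivity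
    rw [Real.norm_of_nonneg (mul_nonneg this h0)]
    exact mul_le_of_le_one_right this h1
  -- Poisson's formula for the branch `exp (α log q)` of `q ^ α`, passed to the boundary
  have poisson_rpow : ∀ α : ℝ, 0 < α → Real.pi * ‖q Complex.I‖ ^ α ≤
      ∫ u : ℝ, (1 + u ^ 2)⁻¹ * ‖ℓ u‖ ^ α := by
    intro α hα
    have hnorm : ∀ z : ℂ, 0 < z.im → ‖Complex.exp (α * Complex.log (q z))‖ = ‖q z‖ ^ α := by
      intro z hz
      rw [Complex.norm_exp, Complex.re_ofReal_mul, Complex.log_re,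
        Real.rpow_def_of_pos (norm_pos_iff.2 (hq0 z hz)), mul_comm]
    have hgd : DifferentiableOn ℂ (fun z => Complex.exp (α * Complex.log (q z))) {z | 0 < z.im} :=
      ((hd.clog fun z hz => Or.inl (hre z hz)).const_mul _).cexp
    have hgb : ∀ z : ℂ, 0 < z.im → ‖Complex.exp (α * Complex.log (q z))‖ ≤ 1 := fun z hz => by
      rw [hnorm z hz]; exact Real.rpow_le_one (norm_nonneg _) (hb z hz) hα.le
    have hn : ∀ n, Real.pi * ‖q (((d n + 1 : ℝ) : ℂ) * Complex.I)‖ ^ α ≤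
        ∫ u : ℝ, (1 + u ^ 2)⁻¹ * ‖q (u + d n * Complex.I)‖ ^ α := by
      intro n
      have h1 := congrArg norm
        (integral_inv_one_add_sq_smul_vertical hgd hgb 0 (hd0 n) one_pos)
      simp only [zero_add, one_mul, Complex.ofReal_zero] at h1
      have hp : 0 < (((d n + 1 : ℝ) : ℂ) * Complex.I).im := by
        have := hd0 n
        simp only [Complex.im_ofReal_mul, Complex.I_im, mul_one]
        linarith
      rw [norm_smul, Real.norm_of_nonneg Real.pi_pos.le, hnorm _ hp] at h1
      rw [← h1]
      refine (norm_integral_le_integral_norm _).trans (le_of_eq ?_)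
      refine integral_congr_ae (ae_of_all _ fun u => ?_)
      have : 0 ≤ (1 + u ^ 2)⁻¹ := by positivity
      simp only [norm_smul, Real.norm_of_nonneg this]
      rw [hnorm _ (by simpa using hd0 n)]
    refine le_of_tendsto_of_tendsto' (b := atTop)
      (f := fun n => Real.pi * ‖q (((d n + 1 : ℝ) : ℂ) * Complex.I)‖ ^ α) ?_ ?_ hn
    · have hc : ContinuousAt q Complex.I :=
        (hd.differentiableAt (hopen.mem_nhds (by simp))).continuousAt
      have h1 : Tendsto (fun n => ((d n + 1 : ℝ) : ℂ) * Complex.I) atTop (𝓝 Complex.I) := by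
        have : Tendsto (fun n => d n + 1) atTop (𝓝 1) := by simpa using hdt.add_const 1
        simpa using ((Complex.continuous_ofReal.tendsto 1).comp this).mul_const Complex.I
      exact ((hc.tendsto.comp h1).norm.rpow_const (Or.inr hα.le)).const_mul _
    · refine tendsto_integral_of_dominated_convergence _ (fun n => ?_)
        integrable_inv_one_add_sq (fun n => ae_of_all _ fun u => ?_) ?_
      · exact hkm.mul ((hqm n).aemeasurable.pow_const α).aestronglyMeasurable
      · exact hdomin u _ (by positivity)
          (Real.rpow_le_one (norm_nonneg _) (hb _ (by simpa using hd0 n)) hα.le)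
      · filter_upwards [hL] with u hu
        exact (hu.rpow_const (Or.inr hα.le)).const_mul _
  have hmain : Tendsto (fun m => ∫ u : ℝ, (1 + u ^ 2)⁻¹ * ‖ℓ u‖ ^ d m) atTop
      (𝓝 (∫ u : ℝ, (1 + u ^ 2)⁻¹ * if ℓ u = 0 then 0 else 1)) ∧
      AEStronglyMeasurable (fun u : ℝ => (1 + u ^ 2)⁻¹ * if ℓ u = 0 then (0 : ℝ) else 1)
        volume := by
    have hpt : ∀ᵐ u : ℝ, Tendsto (fun m => (1 + u ^ 2)⁻¹ * ‖ℓ u‖ ^ d m) atTop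
        (𝓝 ((1 + u ^ 2)⁻¹ * if ℓ u = 0 then 0 else 1)) := by
      refine ae_of_all _ fun u => Tendsto.const_mul _ ?_
      split_ifs with h
      · simp only [h, norm_zero, Real.zero_rpow (hd0 _).ne']
        exact tendsto_const_nhds
      · have := ((Real.continuousAt_const_rpow (b := 0) (norm_ne_zero_iff.2 h)).tendsto).comp hdt
        rwa [Real.rpow_zero] at this
    have hm : ∀ m, AEStronglyMeasurable (fun u : ℝ => (1 + u ^ 2)⁻¹ * ‖ℓ u‖ ^ d m) volume :=
      fun m => hkm.mul (hLm.aemeasurable.pow_const _).aestronglyMeasurable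
    refine ⟨tendsto_integral_of_dominated_convergence _ hm integrable_inv_one_add_sq
      (fun m => ?_) hpt, aestronglyMeasurable_of_tendsto_ae atTop hm hpt⟩
    filter_upwards [hL1] with u hu
    exact hdomin u _ (by positivity) (Real.rpow_le_one (norm_nonneg _) hu (hd0 m).le)
  have hpi : Real.pi ≤ ∫ u : ℝ, (1 + u ^ 2)⁻¹ * if ℓ u = 0 then (0 : ℝ) else 1 := by
    refine le_of_tendsto_of_tendsto' (b := atTop)
      (f := fun m => Real.pi * ‖q Complex.I‖ ^ d m) ?_ hmain.1 fun m => poisson_rpow _ (hd0 m)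
    have := ((Real.continuousAt_const_rpow (b := 0)
      (norm_ne_zero_iff.2 (hq0 Complex.I (by simp)))).tendsto).comp hdt
    simpa using this.const_mul Real.pi
  have hind : Integrable fun u : ℝ => (1 + u ^ 2)⁻¹ * if ℓ u = 0 then (0 : ℝ) else 1 :=
    integrable_inv_one_add_sq.mono' hmain.2
      (ae_of_all _ fun u => hdomin u _ (by split_ifs <;> simp) (by split_ifs <;> simp))
  have hnn : 0 ≤ fun u : ℝ => (1 + u ^ 2)⁻¹ - (1 + u ^ 2)⁻¹ * if ℓ u = 0 then (0 : ℝ) else 1 := by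
    intro u
    have : 0 ≤ (1 + u ^ 2)⁻¹ := by positivity
    simp only [Pi.zero_apply]
    split_ifs <;> simp [this]
  have hzero := (integral_eq_zero_iff_of_nonneg hnn (integrable_inv_one_add_sq.sub hind)).1
    (le_antisymm (by
      rw [integral_sub integrable_inv_one_add_sq hind, integral_univ_inv_one_add_sq]
      linarith) (integral_nonneg hnn))
  filter_upwards [hzero, hℓ] with u hu hu2 hcon
  have h0 : ℓ u = 0 := tendsto_nhds_unique hu2 hcon
  simp only [h0, if_true, mul_zero, sub_zero, Pi.zero_apply, inv_eq_zero] at hu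
  nlinarith [sq_nonneg u]

/-- An analytic function from the upper half-plane to its closure has a finite vertical limit at
almost every point of the real line: with `q = 1 / (1 - i f)` it is `i (1 / q - 1)`, and the
bounded function `q` has almost everywhere a nonzero vertical limit. -/
lemma ae_exists_tendsto_vertical_of_im_nonneg {f : ℂ → ℂ}
    (hd : DifferentiableOn ℂ f {z | 0 < z.im}) (him : ∀ z : ℂ, 0 < z.im → 0 ≤ (f z).im) :
    ∀ᵐ t : ℝ, ∃ ℓ : ℂ, Tendsto (fun ε : ℝ => f (t + ε * Complex.I)) (𝓝[>] 0) (𝓝 ℓ) := by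
  have hre : ∀ z : ℂ, 0 < z.im → 1 ≤ (1 - Complex.I * f z).re := fun z hz => by
    simpa using him z hz
  have hne : ∀ z : ℂ, 0 < z.im → 1 - Complex.I * f z ≠ 0 := fun z hz h => by
    have := hre z hz; rw [h] at this; simp at this; linarith
  have hqd : DifferentiableOn ℂ (fun z => (1 - Complex.I * f z)⁻¹) {z | 0 < z.im} :=
    ((hd.const_mul _).const_sub _).fun_inv fun z hz => hne z hz
  have hqb : ∀ z : ℂ, 0 < z.im → ‖(1 - Complex.I * f z)⁻¹‖ ≤ 1 := fun z hz => by
    rw [norm_inv]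
    exact inv_le_one_of_one_le₀ ((hre z hz).trans (Complex.re_le_norm _))
  have hqre : ∀ z : ℂ, 0 < z.im → 0 < ((1 - Complex.I * f z)⁻¹).re := fun z hz => by
    rw [Complex.inv_re]
    exact div_pos (by linarith [hre z hz]) (Complex.normSq_pos.2 (hne z hz))
  filter_upwards [ae_exists_tendsto_vertical_of_bounded hqd hqb,
    ae_not_tendsto_vertical_zero hqd hqb hqre] with t ⟨ℓ, hℓ⟩ hn
  have hℓ0 : ℓ ≠ 0 := fun h => hn (h ▸ hℓ)
  refine ⟨Complex.I * (ℓ⁻¹ - 1), (((hℓ.inv₀ hℓ0).sub_const 1).const_mul Complex.I).congr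
    fun ε => ?_⟩
  rw [inv_inv]
  linear_combination (-f (t + ε * Complex.I)) * Complex.I_sq

/-! ### Scalar Nevanlinna functions -/

/-- The kernel `(t - z)⁻¹ - t (1 + t²)⁻¹` of the Nevanlinna representation. -/
noncomputable def nevanlinnaKernel (z : ℂ) (t : ℝ) : ℂ :=
  ((t : ℂ) - z)⁻¹ - (t : ℂ) * (1 + (t : ℂ) ^ 2)⁻¹

/-- The scalar function `c + d z + ∫ ((t - z)⁻¹ - t (1 + t²)⁻¹) dμ(t)`. The formula is used for all
complex `z`, not only in the upper half-plane: it continues the function analytically through the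
open intervals which are null sets of `μ`. -/
noncomputable def nevanlinna (c d : ℝ) (μ : Measure ℝ) (z : ℂ) : ℂ :=
  c + z * d + ∫ t, nevanlinnaKernel z t ∂μ

lemma measurable_nevanlinnaKernel (z : ℂ) : Measurable (nevanlinnaKernel z) := by
  unfold nevanlinnaKernel
  fun_prop

lemma one_add_sq_ne_zero (t : ℝ) : (1 + (t : ℂ) ^ 2) ≠ 0 := by
  have : (1 + t ^ 2 : ℝ) ≠ 0 := by positivity
  exact_mod_cast this

lemma norm_nevanlinnaKernel_le {z : ℂ} {t r : ℝ} (hr : 0 < r) (h : r ≤ ‖(t : ℂ) - z‖) :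
    ‖nevanlinnaKernel z t‖ ≤ ((1 + ‖z‖ ^ 2) / r + ‖z‖) * (1 + t ^ 2)⁻¹ := by
  have hn : 0 < ‖(t : ℂ) - z‖ := hr.trans_le h
  have h0 : (t : ℂ) - z ≠ 0 := norm_pos_iff.1 hn
  have e : nevanlinnaKernel z t = ((1 + z ^ 2) * ((t : ℂ) - z)⁻¹ + z) * (1 + (t : ℂ) ^ 2)⁻¹ := by
    have := one_add_sq_ne_zero t
    unfold nevanlinnaKernel
    field_simp
    ring
  have e2 : ‖(1 + (t : ℂ) ^ 2)⁻¹‖ = (1 + t ^ 2)⁻¹ := by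
    rw [norm_inv]
    congr 1
    have : (1 + (t : ℂ) ^ 2) = ((1 + t ^ 2 : ℝ) : ℂ) := by push_cast; rfl
    rw [this, Complex.norm_real, Real.norm_of_nonneg (by positivity)]
  rw [e, norm_mul, e2]
  refine mul_le_mul_of_nonneg_right ((norm_add_le _ _).trans ?_) (by positivity)
  gcongr
  rw [norm_mul, norm_inv, ← div_eq_mul_inv]
  gcongr
  exact (norm_add_le _ _).trans (by simp)

lemma integrable_nevanlinnaKernel {μ : Measure ℝ}
    (hμ : Integrable (fun t : ℝ => (1 + t ^ 2)⁻¹) μ) {z : ℂ} {r : ℝ} (hr : 0 < r)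
    (h : ∀ᵐ t : ℝ ∂μ, r ≤ ‖(t : ℂ) - z‖) : Integrable (nevanlinnaKernel z) μ := by
  refine (hμ.const_mul ((1 + ‖z‖ ^ 2) / r + ‖z‖)).mono'
    (measurable_nevanlinnaKernel z).aestronglyMeasurable ?_
  filter_upwards [h] with t ht using norm_nevanlinnaKernel_le hr ht

lemma im_le_norm_ofReal_sub (z : ℂ) (t : ℝ) : z.im ≤ ‖(t : ℂ) - z‖ := by
  have := Complex.abs_im_le_norm ((t : ℂ) - z)
  simp at this
  exact (le_abs_self _).trans this

lemma integrable_nevanlinnaKernel_of_im_pos {μ : Measure ℝ}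
    (hμ : Integrable (fun t : ℝ => (1 + t ^ 2)⁻¹) μ) {z : ℂ} (hz : 0 < z.im) :
    Integrable (nevanlinnaKernel z) μ :=
  integrable_nevanlinnaKernel hμ hz (ae_of_all _ fun t => im_le_norm_ofReal_sub z t)

lemma differentiableOn_nevanlinna {μ : Measure ℝ}
    (hμ : Integrable (fun t : ℝ => (1 + t ^ 2)⁻¹) μ) (c d : ℝ) {U : Set ℂ} (hU : IsOpen U)
    (h0 : μ {t | (t : ℂ) ∈ U} = 0) : DifferentiableOn ℂ (nevanlinna c d μ) U := by
  intro z₀ hz₀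
  obtain ⟨r', hr', hball⟩ := Metric.isOpen_iff.1 hU z₀ hz₀
  set r := r' / 2 with hrdef
  have hr : 0 < r := by positivity
  have hae : ∀ᵐ t : ℝ ∂μ, ∀ z ∈ Metric.ball z₀ r, r ≤ ‖(t : ℂ) - z‖ := by
    have : ∀ᵐ t : ℝ ∂μ, (t : ℂ) ∉ U := by
      rw [ae_iff]; simpa using h0
    filter_upwards [this] with t ht z hz
    by_contra hcon
    push Not at hcon
    refine ht (hball ?_)
    rw [Metric.mem_ball, dist_eq_norm] at hz ⊢
    calc ‖(t : ℂ) - z₀‖ = ‖((t : ℂ) - z) + (z - z₀)‖ := by ring_nf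
      _ ≤ ‖(t : ℂ) - z‖ + ‖z - z₀‖ := norm_add_le _ _
      _ < r' := by linarith
  set R := ‖z₀‖ + r with hR
  have hbd : ∀ᵐ t : ℝ ∂μ, ∀ z ∈ Metric.ball z₀ r,
      ‖((((t : ℂ) - z) ^ 2)⁻¹ : ℂ)‖ ≤ (2 + (1 + 2 * R ^ 2) / r ^ 2) * (1 + t ^ 2)⁻¹ := by
    filter_upwards [hae] with t ht z hz
    have h1 := ht z hz
    have hn : 0 < ‖(t : ℂ) - z‖ := hr.trans_le h1
    have hzR : ‖z‖ ≤ R := by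
      rw [Metric.mem_ball, dist_eq_norm] at hz
      have := norm_add_le z₀ (z - z₀)
      rw [add_sub_cancel] at this
      linarith
    have htn : |t| ≤ ‖(t : ℂ) - z‖ + R := by
      have := norm_add_le ((t : ℂ) - z) z
      rw [sub_add_cancel, Complex.norm_real, Real.norm_eq_abs] at this
      linarith
    have hsq : t ^ 2 ≤ 2 * ‖(t : ℂ) - z‖ ^ 2 + 2 * R ^ 2 := by
      rw [← sq_abs t]
      nlinarith [sq_nonneg (‖(t : ℂ) - z‖ - R), abs_nonneg t]
    have hq : 1 + 2 * R ^ 2 ≤ (1 + 2 * R ^ 2) / r ^ 2 * ‖(t : ℂ) - z‖ ^ 2 := by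
      rw [div_mul_eq_mul_div, le_div_iff₀ (by positivity)]
      gcongr
    rw [norm_inv, norm_pow, ← div_eq_mul_inv, le_div_iff₀ (by positivity),
      inv_mul_le_iff₀ (by positivity)]
    nlinarith
  have hder := hasDerivAt_integral_of_dominated_loc_of_deriv_le (μ := μ) (𝕜 := ℂ)
    (F := fun z t => nevanlinnaKernel z t) (F' := fun z t => (((t : ℂ) - z) ^ 2)⁻¹)
    (x₀ := z₀) (s := Metric.ball z₀ r)
    (bound := fun t => (2 + (1 + 2 * R ^ 2) / r ^ 2) * (1 + t ^ 2)⁻¹)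
    (Metric.ball_mem_nhds z₀ hr)
    (Eventually.of_forall fun z => (measurable_nevanlinnaKernel z).aestronglyMeasurable)
    (integrable_nevanlinnaKernel hμ hr (by
      filter_upwards [hae] with t ht using ht z₀ (Metric.mem_ball_self hr)))
    (by
      have : Measurable fun t : ℝ => (((t : ℂ) - z₀) ^ 2)⁻¹ := by fun_prop
      exact this.aestronglyMeasurable) hbd (hμ.const_mul _) (by
      filter_upwards [hae] with t ht z hz
      have hne : (t : ℂ) - z ≠ 0 := norm_pos_iff.1 (hr.trans_le (ht z hz))
      have := (((hasDerivAt_id z).const_sub (t : ℂ)).inv hne).sub_const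
        ((t : ℂ) * (1 + (t : ℂ) ^ 2)⁻¹)
      simp only [neg_neg, id_eq, one_div] at this
      exact this)
  refine DifferentiableAt.differentiableWithinAt ?_
  exact ((differentiableAt_const _).add (differentiableAt_id.mul_const _)).add
    hder.2.differentiableAt

lemma differentiableOn_nevanlinna_upperHalfPlane {μ : Measure ℝ}
    (hμ : Integrable (fun t : ℝ => (1 + t ^ 2)⁻¹) μ) (c d : ℝ) :
    DifferentiableOn ℂ (nevanlinna c d μ) {z | 0 < z.im} :=
  differentiableOn_nevanlinna hμ c d (isOpen_lt continuous_const Complex.continuous_im)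
    (by simp)

lemma nevanlinnaKernel_im (t ε s : ℝ) :
    (nevanlinnaKernel (t + ε * Complex.I) s).im = ε / ((s - t) ^ 2 + ε ^ 2) := by
  have e : (s : ℂ) * (1 + (s : ℂ) ^ 2)⁻¹ = ((s * (1 + s ^ 2)⁻¹ : ℝ) : ℂ) := by push_cast; rfl
  unfold nevanlinnaKernel
  rw [e, Complex.sub_im, Complex.ofReal_im, sub_zero, Complex.inv_im, Complex.normSq_apply]
  simp
  ring_nf

lemma nevanlinna_im {μ : Measure ℝ} (hμ : Integrable (fun t : ℝ => (1 + t ^ 2)⁻¹) μ)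
    (c d t : ℝ) {ε : ℝ} (hε : 0 < ε) :
    (nevanlinna c d μ (t + ε * Complex.I)).im =
      d * ε + ∫ s, ε / ((s - t) ^ 2 + ε ^ 2) ∂μ := by
  have hi : Integrable (nevanlinnaKernel (t + ε * Complex.I)) μ :=
    integrable_nevanlinnaKernel_of_im_pos hμ (by simpa using hε)
  have h := integral_im hi
  simp only [RCLike.im_eq_complex_im, nevanlinnaKernel_im] at h
  rw [nevanlinna, Complex.add_im, ← h]
  simp [mul_comm]

lemma integrable_poissonKernel {μ : Measure ℝ} (hμ : Integrable (fun t : ℝ => (1 + t ^ 2)⁻¹) μ)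
    (t : ℝ) {ε : ℝ} (hε : 0 < ε) : Integrable (fun s => ε / ((s - t) ^ 2 + ε ^ 2)) μ := by
  have hi : Integrable (nevanlinnaKernel (t + ε * Complex.I)) μ :=
    integrable_nevanlinnaKernel_of_im_pos hμ (by simpa using hε)
  have := hi.im
  simpa only [RCLike.im_eq_complex_im, nevanlinnaKernel_im] using this

lemma nevanlinna_im_nonneg {μ : Measure ℝ} (hμ : Integrable (fun t : ℝ => (1 + t ^ 2)⁻¹) μ)
    (c : ℝ) {d : ℝ} (hd : 0 ≤ d) {z : ℂ} (hz : 0 < z.im) : 0 ≤ (nevanlinna c d μ z).im := by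
  rw [← Complex.re_add_im z, nevanlinna_im hμ c d _ hz]
  exact add_nonneg (by positivity) (integral_nonneg fun s => by positivity)

/-- On the real line the function is real; where the integral diverges, this holds because its junk
value zero is real. -/
lemma nevanlinna_ofReal_im (c d : ℝ) (μ : Measure ℝ) (t : ℝ) :
    (nevanlinna c d μ t).im = 0 := by
  have e : ∀ s, nevanlinnaKernel t s = (((s - t)⁻¹ - s * (1 + s ^ 2)⁻¹ : ℝ) : ℂ) := fun s => by
    unfold nevanlinnaKernel; push_cast; rfl
  rw [nevanlinna]
  simp_rw [e]
  rw [integral_complex_ofReal]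
  simp

lemma ae_exists_tendsto_nevanlinna {μ : Measure ℝ}
    (hμ : Integrable (fun t : ℝ => (1 + t ^ 2)⁻¹) μ) (c : ℝ) {d : ℝ} (hd : 0 ≤ d) :
    ∀ᵐ t : ℝ, ∃ ℓ : ℂ,
      Tendsto (fun ε : ℝ => nevanlinna c d μ (t + ε * Complex.I)) (𝓝[>] 0) (𝓝 ℓ) :=
  ae_exists_tendsto_vertical_of_im_nonneg (differentiableOn_nevanlinna_upperHalfPlane hμ c d)
    fun _ hz => nevanlinna_im_nonneg hμ c hd hz

/-- The imaginary part dominates the averages of the measure over small intervals. -/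
lemma measure_closedBall_le_im {μ : Measure ℝ}
    (hμ : Integrable (fun t : ℝ => (1 + t ^ 2)⁻¹) μ) (c : ℝ) {d : ℝ} (hd : 0 ≤ d) (t : ℝ)
    {ε : ℝ} (hε : 0 < ε) :
    μ (Metric.closedBall t ε) ≤
      ENNReal.ofReal (2 * ε * (nevanlinna c d μ (t + ε * Complex.I)).im) := by
  have h1 : ENNReal.ofReal (1 / (2 * ε)) * μ (Metric.closedBall t ε) ≤
      ENNReal.ofReal ((nevanlinna c d μ (t + ε * Complex.I)).im) := by
    rw [nevanlinna_im hμ c d t hε]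
    refine le_trans ?_ (ENNReal.ofReal_le_ofReal (le_add_of_nonneg_left (by positivity)))
    rw [ofReal_integral_eq_lintegral_ofReal (integrable_poissonKernel hμ t hε)
      (ae_of_all _ fun s => by positivity), ← setLIntegral_const]
    -- on `[t - ε, t + ε]` the kernel is at least `ε / (ε² + ε²) = 1 / (2 ε)`
    refine (setLIntegral_mono' Metric.isClosed_closedBall.measurableSet fun s hs => ?_).trans
      (setLIntegral_le_lintegral _ _)
    refine ENNReal.ofReal_le_ofReal ?_
    rw [div_le_div_iff₀ (by positivity) (by positivity)]
    rw [Metric.mem_closedBall, Real.dist_eq] at hs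
    have : (s - t) ^ 2 ≤ ε ^ 2 := sq_le_sq' (by linarith [neg_abs_le (s - t)])
      ((le_abs_self _).trans hs)
    nlinarith
  have h2 := mul_le_mul_right h1 (ENNReal.ofReal (2 * ε))
  rwa [← mul_assoc, ← ENNReal.ofReal_mul (by positivity), mul_one_div_cancel (by positivity),
    ENNReal.ofReal_one, one_mul, ← ENNReal.ofReal_mul (by positivity)] at h2

/-- The measure of a Nevanlinna function does not charge the set of points where the imaginary
part has vertical limit zero: there the density of Lebesgue measure with respect to it would be
infinite. -/
lemma ae_not_tendsto_im_nevanlinna_zero {μ : Measure ℝ} [IsLocallyFiniteMeasure μ]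
    (hμ : Integrable (fun t : ℝ => (1 + t ^ 2)⁻¹) μ) (c : ℝ) {d : ℝ} (hd : 0 ≤ d) :
    ∀ᵐ t : ℝ ∂μ, ¬ Tendsto (fun ε : ℝ => (nevanlinna c d μ (t + ε * Complex.I)).im) (𝓝[>] 0)
      (𝓝 0) := by
  filter_upwards [Besicovitch.ae_tendsto_rnDeriv volume μ,
    Measure.rnDeriv_lt_top volume μ] with t ht hlt hcon
  refine hlt.ne (ENNReal.eq_top_of_forall_nnreal_le fun K => ?_)
  refine ge_of_tendsto ht ?_
  have hη : (0 : ℝ) < ((K : ℝ) + 1)⁻¹ := by positivity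
  filter_upwards [hcon.eventually (gt_mem_nhds hη), self_mem_nhdsWithin] with ε h1 (hε : 0 < ε)
  have h2 : μ (Metric.closedBall t ε) ≤ ENNReal.ofReal (2 * ε * ((K : ℝ) + 1)⁻¹) :=
    (measure_closedBall_le_im hμ c hd t hε).trans
      (ENNReal.ofReal_le_ofReal (by gcongr))
  rw [Real.volume_closedBall]
  refine le_trans ?_ (ENNReal.div_le_div_left h2 _)
  rw [← ENNReal.ofReal_div_of_pos (by positivity)]
  have e : 2 * ε / (2 * ε * ((K : ℝ) + 1)⁻¹) = K + 1 := by field_simp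
  rw [e, ← ENNReal.ofReal_coe_nnreal]
  exact ENNReal.ofReal_le_ofReal (by simp)

/-- The part of the Poisson integral near `t` is small where the measure is small on all small
intervals around `t`. By the layer cake formula only the measures of these intervals matter. -/
lemma setLIntegral_poissonKernel_le {μ : Measure ℝ} (t : ℝ) {δ η ε : ℝ} (hε : 0 < ε)
    (hδ : 0 < δ) (hη : 0 ≤ η)
    (h : ∀ r, 0 < r → r ≤ δ → μ (Metric.closedBall t r) ≤ ENNReal.ofReal (η * r)) :
    ∫⁻ s in Metric.closedBall t δ, ENNReal.ofReal (ε / ((s - t) ^ 2 + ε ^ 2)) ∂μ ≤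
      ENNReal.ofReal (2 * η) := by
  have hm : Measurable fun s : ℝ => ε / ((s - t) ^ 2 + ε ^ 2) := by fun_prop
  rw [lintegral_eq_lintegral_meas_le _ (ae_of_all _ fun s => by positivity) hm.aemeasurable]
  -- the superlevel set at height `x` lies in the ball of radius `√(ε / x)` and is empty for
  -- `x > 1 / ε`, and `∫₀^{1/ε} η √(ε / x) dx = 2 η`
  set g : ℝ → ℝ := fun x => η * Real.sqrt ε * x ^ (-(1 / 2) : ℝ) with hg
  have hbound : ∀ x ∈ Set.Ioi (0 : ℝ),
      (μ.restrict (Metric.closedBall t δ)) {s | x ≤ ε / ((s - t) ^ 2 + ε ^ 2)} ≤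
        (Set.Iic ε⁻¹).indicator (fun x => ENNReal.ofReal (g x)) x := by
    intro x (hx : 0 < x)
    by_cases hxε : x ≤ ε⁻¹
    · rw [Set.indicator_of_mem (show x ∈ Set.Iic ε⁻¹ from hxε)]
      rw [Measure.restrict_apply (measurableSet_le measurable_const hm)]
      have hsub : {s | x ≤ ε / ((s - t) ^ 2 + ε ^ 2)} ∩ Metric.closedBall t δ ⊆
          Metric.closedBall t (min (Real.sqrt (ε / x)) δ) := by
        rintro s ⟨hs, hsδ⟩
        rw [Metric.mem_closedBall] at hsδ ⊢
        refine le_min ?_ hsδ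
        rw [Real.dist_eq]
        refine Real.abs_le_sqrt ?_
        have hs' : x ≤ ε / ((s - t) ^ 2 + ε ^ 2) := hs
        rw [le_div_iff₀ (by positivity)] at hs'
        rw [le_div_iff₀ hx]
        nlinarith [sq_nonneg ε]
      refine (measure_mono hsub).trans ((h _ (lt_min (Real.sqrt_pos.2 (by positivity)) hδ)
        (min_le_right _ _)).trans (ENNReal.ofReal_le_ofReal ?_))
      refine (mul_le_mul_of_nonneg_left (min_le_left _ _) hη).trans (le_of_eq ?_)
      rw [hg, Real.sqrt_div hε.le]
      simp only
      rw [Real.rpow_neg hx.le, ← Real.sqrt_eq_rpow]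
      ring
    · have : {s | x ≤ ε / ((s - t) ^ 2 + ε ^ 2)} = ∅ := by
        ext s
        simp only [Set.mem_ofPred_eq, Set.mem_empty_iff_false, iff_false, not_le]
        refine lt_of_le_of_lt ?_ (not_le.1 hxε)
        rw [inv_eq_one_div, div_le_div_iff₀ (by positivity) hε]
        nlinarith [sq_nonneg (s - t)]
      rw [this, measure_empty]
      exact zero_le
  refine (setLIntegral_mono' measurableSet_Ioi hbound).trans ?_
  rw [setLIntegral_indicator measurableSet_Iic, Set.inter_comm, Set.Ioi_inter_Iic]
  have hint : IntervalIntegrable (fun x : ℝ => x ^ (-(1 / 2) : ℝ)) volume 0 ε⁻¹ :=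
    intervalIntegral.intervalIntegrable_rpow' (by norm_num)
  have hint' : IntegrableOn g (Set.Ioc 0 ε⁻¹) :=
    ((intervalIntegrable_iff_integrableOn_Ioc_of_le (by positivity)).1 hint).const_mul _
  rw [← ofReal_integral_eq_lintegral_ofReal hint'
    ((ae_restrict_iff' measurableSet_Ioc).2 (ae_of_all _ fun x hx => by
      have := hx.1; simp only [hg, Pi.zero_apply]; positivity)),
    ← intervalIntegral.integral_of_le (by positivity)]
  refine ENNReal.ofReal_le_ofReal (le_of_eq ?_)
  simp only [hg]
  rw [intervalIntegral.integral_const_mul, integral_rpow (Or.inl (by norm_num))]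
  have e : (-(1 / 2) + 1 : ℝ) = 1 / 2 := by norm_num
  rw [e, Real.zero_rpow (by norm_num), sub_zero, ← Real.sqrt_eq_rpow, Real.sqrt_inv]
  field_simp

/-- At almost every point the vertical limit of the imaginary part vanishes exactly where the
density of the absolutely continuous part of the measure does. -/
lemma ae_tendsto_im_nevanlinna_eq_zero_iff {μ : Measure ℝ} [IsLocallyFiniteMeasure μ]
    (hμ : Integrable (fun t : ℝ => (1 + t ^ 2)⁻¹) μ) (c : ℝ) {d : ℝ} (hd : 0 ≤ d) :
    ∀ᵐ t : ℝ, ∀ ℓ : ℝ,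
      Tendsto (fun ε : ℝ => (nevanlinna c d μ (t + ε * Complex.I)).im) (𝓝[>] 0) (𝓝 ℓ) →
        (ℓ = 0 ↔ μ.rnDeriv volume t = 0) := by
  filter_upwards [Besicovitch.ae_tendsto_rnDeriv μ volume] with t ht ℓ hℓ
  have hpos : ∀ᶠ ε : ℝ in 𝓝[>] 0, 0 ≤ (nevanlinna c d μ (t + ε * Complex.I)).im := by
    filter_upwards [self_mem_nhdsWithin] with ε hε
    exact nevanlinna_im_nonneg hμ c hd (by simpa using hε)
  have hℓ0 : 0 ≤ ℓ := ge_of_tendsto hℓ hpos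
  constructor
  · rintro rfl
    have hle : μ.rnDeriv volume t ≤ ENNReal.ofReal 0 := by
      refine le_of_tendsto_of_tendsto ht (ENNReal.tendsto_ofReal hℓ) ?_
      filter_upwards [self_mem_nhdsWithin] with ε (hε : 0 < ε)
      rw [Real.volume_closedBall]
      refine ENNReal.div_le_of_le_mul ?_
      rw [← ENNReal.ofReal_mul' (by positivity), mul_comm]
      exact measure_closedBall_le_im hμ c hd t hε
    simpa using hle
  · intro hz
    rw [hz] at ht
    refine le_antisymm (le_of_forall_pos_le_add fun η hη => ?_) hℓ0
    have hev := ht.eventually (gt_mem_nhds (ENNReal.ofReal_pos.2 (by positivity : 0 < η / 4)))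
    obtain ⟨δ, hδ, hball⟩ := mem_nhdsGT_iff_exists_Ioc_subset.1 hev
    have hδ' : (0 : ℝ) < δ := hδ
    have hr : ∀ r, 0 < r → r ≤ δ →
        μ (Metric.closedBall t r) ≤ ENNReal.ofReal (η / 2 * r) := by
      intro r h0 h1
      have h2 : μ (Metric.closedBall t r) / volume (Metric.closedBall t r) <
        ENNReal.ofReal (η / 4) := hball ⟨h0, h1⟩
      rw [Real.volume_closedBall] at h2
      have h3 := (ENNReal.div_le_iff_le_mul (Or.inl (ENNReal.ofReal_pos.2 (by positivity)).ne')
        (Or.inl ENNReal.ofReal_ne_top)).1 h2.le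
      rw [← ENNReal.ofReal_mul (by positivity)] at h3
      exact h3.trans_eq (by ring_nf)
    -- `1 + s² ≤ K (s - t)²` for `|s - t| ≥ δ`, so the far part of the Poisson integral is `O(ε)`
    set K := 2 + (1 + 2 * t ^ 2) / δ ^ 2 with hK
    set J := ∫ s, (1 + s ^ 2)⁻¹ ∂μ with hJ
    have hmain : ∀ ε : ℝ, 0 < ε →
        (nevanlinna c d μ (t + ε * Complex.I)).im ≤ d * ε + (η + ε * (K * J)) := by
      intro ε hε
      have hP := integrable_poissonKernel hμ t hε
      rw [nevanlinna_im hμ c d t hε,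
        ← integral_add_compl (s := Metric.closedBall t δ)
          Metric.isClosed_closedBall.measurableSet hP]
      refine add_le_add le_rfl (add_le_add ?_ ?_)
      · rw [← ENNReal.ofReal_le_ofReal_iff hη.le, ofReal_integral_eq_lintegral_ofReal
          hP.integrableOn (ae_of_all _ fun s => by positivity)]
        refine (setLIntegral_poissonKernel_le t hε hδ' (by positivity) hr).trans_eq ?_
        congr 1; ring
      · have hle : ∫ s in (Metric.closedBall t δ)ᶜ, ε / ((s - t) ^ 2 + ε ^ 2) ∂μ ≤
            ∫ s in (Metric.closedBall t δ)ᶜ, ε * K * (1 + s ^ 2)⁻¹ ∂μ := by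
          refine setIntegral_mono_on hP.integrableOn (hμ.const_mul _).integrableOn
            Metric.isClosed_closedBall.measurableSet.compl fun s hs => ?_
          rw [Set.mem_compl_iff, Metric.mem_closedBall, Real.dist_eq, not_le] at hs
          have hs2 : δ ^ 2 ≤ (s - t) ^ 2 := by
            rw [← sq_abs (s - t)]; gcongr
          have hq : 1 + 2 * t ^ 2 ≤ (1 + 2 * t ^ 2) / δ ^ 2 * (s - t) ^ 2 := by
            rw [div_mul_eq_mul_div, le_div_iff₀ (by positivity)]
            gcongr
          have hs3 : 1 + s ^ 2 ≤ K * ((s - t) ^ 2 + ε ^ 2) := by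
            have : 1 + s ^ 2 ≤ K * (s - t) ^ 2 := by
              rw [hK]; nlinarith [sq_nonneg (s - 2 * t)]
            have hK0 : 0 ≤ K := by positivity
            nlinarith [mul_nonneg hK0 (sq_nonneg ε)]
          rw [← div_eq_mul_inv, div_le_div_iff₀ (by positivity) (by positivity), mul_assoc]
          exact mul_le_mul_of_nonneg_left hs3 hε.le
        refine hle.trans ?_
        rw [integral_const_mul, mul_assoc]
        have hK0 : 0 ≤ K := by positivity
        refine mul_le_mul_of_nonneg_left (mul_le_mul_of_nonneg_left ?_ hK0) hε.le
        exact setIntegral_le_integral hμ (ae_of_all _ fun s => by positivity)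
    have hlim : Tendsto (fun ε : ℝ => d * ε + (η + ε * (K * J))) (𝓝[>] 0) (𝓝 (0 + η)) := by
      have : Continuous fun ε : ℝ => d * ε + (η + ε * (K * J)) := by fun_prop
      have h := this.tendsto 0
      simp only [mul_zero, zero_mul, add_zero, zero_add] at h ⊢
      exact h.mono_left nhdsWithin_le_nhds
    refine le_of_tendsto_of_tendsto hℓ hlim ?_
    filter_upwards [self_mem_nhdsWithin] with ε hε using hmain ε hε

/-! ### Matrices, their imaginary parts and linear fractional transformations -/

namespace HerglotzMatrix

variable {n : ℕ}

/-- The quadratic form `(x, X x)` of a matrix. -/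
def quadForm (X : Matrix (Fin n) (Fin n) ℂ) (x : Fin n → ℂ) : ℂ := star x ⬝ᵥ X.mulVec x

/-- Polarization: the coefficients of a matrix in terms of its quadratic form, written for an
arbitrary function `q` in place of the form. -/
noncomputable def polar (q : (Fin n → ℂ) → ℂ) : Matrix (Fin n) (Fin n) ℂ := fun j k =>
  1 / 2 * ((q (Pi.single j 1 + Pi.single k 1) - q (Pi.single j 1) - q (Pi.single k 1)) -
    Complex.I * (q (Pi.single j 1 + Complex.I • Pi.single k 1) - q (Pi.single j 1) -
      q (Pi.single k 1)))

lemma polar_quadForm (X : Matrix (Fin n) (Fin n) ℂ) : polar (quadForm X) = X := by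
  have hs : ∀ (j : Fin n) (v : Fin n → ℂ), star (Pi.single j (1 : ℂ)) ⬝ᵥ v = v j := fun j v => by
    rw [← Pi.single_star, star_one, single_one_dotProduct]
  have hm : ∀ j k : Fin n, X.mulVec (Pi.single k 1) j = X j k := fun j k => by simp
  ext j k
  simp only [polar, quadForm, Matrix.mulVec_add, Matrix.mulVec_smul, star_add, star_smul,
    add_dotProduct, dotProduct_add, smul_dotProduct, dotProduct_smul, hs, hm, smul_eq_mul,
    Complex.star_def, Complex.conj_I]
  linear_combination (-(1 / 2) * X j k + 1 / 2 * Complex.I * X k k + 1 / 2 * X k j) * Complex.I_sq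

lemma quadForm_single (X : Matrix (Fin n) (Fin n) ℂ) (j : Fin n) :
    quadForm X (Pi.single j 1) = X j j := by
  simp [quadForm]

lemma quadForm_conjTranspose (X : Matrix (Fin n) (Fin n) ℂ) (x : Fin n → ℂ) :
    quadForm X.conjTranspose x = star (quadForm X x) := by
  rw [quadForm, quadForm, Matrix.star_dotProduct, Matrix.star_mulVec,
    Matrix.conjTranspose_conjTranspose, Matrix.dotProduct_mulVec, dotProduct_comm]

lemma quadForm_imPart (X : Matrix (Fin n) (Fin n) ℂ) (x : Fin n → ℂ) :
    quadForm (imPart X) x = ((quadForm X x).im : ℂ) := by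
  have h : quadForm (imPart X) x =
      1 / (2 * Complex.I) * (quadForm X x - quadForm X.conjTranspose x) := by
    rw [quadForm, imPart, Matrix.smul_mulVec, Matrix.sub_mulVec, dotProduct_smul,
      dotProduct_sub, smul_eq_mul, quadForm, quadForm]
  rw [h, quadForm_conjTranspose, Complex.star_def, Complex.sub_conj]
  have := Complex.I_ne_zero
  push_cast
  field_simp

lemma imPart_isHermitian (X : Matrix (Fin n) (Fin n) ℂ) : (imPart X).IsHermitian := by
  rw [Matrix.IsHermitian, imPart, Matrix.conjTranspose_smul, Matrix.conjTranspose_sub,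
    Matrix.conjTranspose_conjTranspose, ← neg_sub X, smul_neg, ← neg_smul]
  congr 1
  simp

lemma imPart_posSemidef_iff (X : Matrix (Fin n) (Fin n) ℂ) :
    (imPart X).PosSemidef ↔ ∀ x, 0 ≤ (quadForm X x).im := by
  constructor
  · intro h x
    have h1 := h.dotProduct_mulVec_nonneg x
    change 0 ≤ quadForm (imPart X) x at h1
    rw [quadForm_imPart] at h1
    exact_mod_cast h1
  · intro h
    refine Matrix.PosSemidef.of_dotProduct_mulVec_nonneg (imPart_isHermitian X) fun x => ?_
    change 0 ≤ quadForm (imPart X) x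
    rw [quadForm_imPart]
    exact_mod_cast h x

lemma trace_imPart (X : Matrix (Fin n) (Fin n) ℂ) : (imPart X).trace = (X.trace.im : ℂ) := by
  have h : ∀ j, imPart X j j = ((X j j).im : ℂ) := fun j => by
    rw [← quadForm_single (imPart X), quadForm_imPart, quadForm_single]
  simp [Matrix.trace, h]

lemma continuous_imPart : Continuous (imPart (n := n)) := by
  unfold imPart
  fun_prop

lemma continuous_quadForm (x : Fin n → ℂ) : Continuous fun X => quadForm (n := n) X x := by
  unfold quadForm
  fun_prop

lemma rank_eq_zero_iff (X : Matrix (Fin n) (Fin n) ℂ) : X.rank = 0 ↔ X = 0 := by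
  constructor
  · intro h
    rw [Matrix.rank, Submodule.finrank_eq_zero, LinearMap.range_eq_bot] at h
    exact Matrix.ext_iff_mulVec.2 fun v => by simpa using LinearMap.congr_fun h v
  · rintro rfl
    exact Matrix.rank_zero

/-- The four block identities contained in `A* J A = J`. -/
lemma JUnitary.block_identities {A : Matrix (Fin n ⊕ Fin n) (Fin n ⊕ Fin n) ℂ}
    (hA : A ∈ JUnitary n) :
    A.toBlocks₁₁.conjTranspose * A.toBlocks₂₁ = A.toBlocks₂₁.conjTranspose * A.toBlocks₁₁ ∧
    A.toBlocks₁₁.conjTranspose * A.toBlocks₂₂ = 1 + A.toBlocks₂₁.conjTranspose * A.toBlocks₁₂ ∧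
    A.toBlocks₂₂.conjTranspose * A.toBlocks₁₁ = 1 + A.toBlocks₁₂.conjTranspose * A.toBlocks₂₁ ∧
    A.toBlocks₁₂.conjTranspose * A.toBlocks₂₂ = A.toBlocks₂₂.conjTranspose * A.toBlocks₁₂ := by
  have h : A.conjTranspose * Matrix.J (Fin n) ℂ * A = Matrix.J (Fin n) ℂ := hA
  rw [← Matrix.fromBlocks_toBlocks A] at h
  simp only [Matrix.fromBlocks_conjTranspose, Matrix.J, Matrix.fromBlocks_multiply,
    Matrix.fromBlocks_inj, mul_zero, mul_neg, mul_one, zero_add, add_zero, neg_mul] at h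
  obtain ⟨h1, h2, h3, h4⟩ := h
  refine ⟨?_, ?_, ?_, ?_⟩
  · exact (sub_eq_zero.1 (by rw [← h1]; abel)).symm
  · refine sub_eq_zero.1 ?_
    rw [← neg_neg (1 : Matrix (Fin n) (Fin n) ℂ), ← h2]; abel
  · rw [← h3]; abel
  · exact (sub_eq_zero.1 (by rw [← h4]; abel)).symm

/-- The imaginary parts of `X` and of its linear fractional transform `Y` are congruent. -/
lemma conjTranspose_mul_imPart_mul {A : Matrix (Fin n ⊕ Fin n) (Fin n ⊕ Fin n) ℂ}
    (hA : A ∈ JUnitary n) {X Y : Matrix (Fin n) (Fin n) ℂ}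
    (h : Y * (A.toBlocks₁₁ + A.toBlocks₁₂ * X) = A.toBlocks₂₁ + A.toBlocks₂₂ * X) :
    (A.toBlocks₁₁ + A.toBlocks₁₂ * X).conjTranspose * imPart Y *
      (A.toBlocks₁₁ + A.toBlocks₁₂ * X) = imPart X := by
  obtain ⟨h1, h2, h3, h4⟩ := JUnitary.block_identities hA
  set a := A.toBlocks₁₁
  set b := A.toBlocks₁₂
  set c := A.toBlocks₂₁
  set d := A.toBlocks₂₂
  have e : (a + b * X).conjTranspose * (Y - Y.conjTranspose) * (a + b * X) =
      (a + b * X).conjTranspose * (Y * (a + b * X)) -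
        (Y * (a + b * X)).conjTranspose * (a + b * X) := by
    rw [Matrix.conjTranspose_mul Y]
    simp only [mul_sub, sub_mul, mul_assoc]
  have e2 : (a + b * X).conjTranspose * (c + d * X) - (c + d * X).conjTranspose * (a + b * X) =
      (a.conjTranspose * c - c.conjTranspose * a) +
      (a.conjTranspose * d - c.conjTranspose * b) * X -
      X.conjTranspose * (d.conjTranspose * a - b.conjTranspose * c) +
      X.conjTranspose * (b.conjTranspose * d - d.conjTranspose * b) * X := by
    simp only [Matrix.conjTranspose_add, Matrix.conjTranspose_mul]
    noncomm_ring
  have e3 : (a + b * X).conjTranspose * (Y - Y.conjTranspose) * (a + b * X) =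
      X - X.conjTranspose := by
    rw [e, h, e2, h1, h2, h3, h4]
    simp
  rw [imPart, imPart, Matrix.mul_smul, Matrix.smul_mul, e3]

/-- The denominator of a linear fractional transformation is invertible at each point where the
transform has a finite value. -/
lemma isUnit_det_denominator {A : Matrix (Fin n ⊕ Fin n) (Fin n ⊕ Fin n) ℂ}
    (hA : A ∈ JUnitary n) {X Y : Matrix (Fin n) (Fin n) ℂ}
    (h : Y * (A.toBlocks₁₁ + A.toBlocks₁₂ * X) = A.toBlocks₂₁ + A.toBlocks₂₂ * X) :
    IsUnit (A.toBlocks₁₁ + A.toBlocks₁₂ * X).det := by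
  obtain ⟨h1, h2, h3, h4⟩ := JUnitary.block_identities hA
  set a := A.toBlocks₁₁
  set b := A.toBlocks₁₂
  set c := A.toBlocks₂₁
  set d := A.toBlocks₂₂
  refine Matrix.isUnit_det_of_left_inverse (B := d.conjTranspose - b.conjTranspose * Y) ?_
  have e : (d.conjTranspose - b.conjTranspose * Y) * (a + b * X) =
      d.conjTranspose * (a + b * X) - b.conjTranspose * (Y * (a + b * X)) := by
    rw [sub_mul, mul_assoc]
  have e2 : d.conjTranspose * (a + b * X) - b.conjTranspose * (c + d * X) =
      (d.conjTranspose * a - b.conjTranspose * c) -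
        (b.conjTranspose * d - d.conjTranspose * b) * X := by
    noncomm_ring
  rw [e, h, e2, h3, h4]
  simp

lemma rank_imPart_eq {A : Matrix (Fin n ⊕ Fin n) (Fin n ⊕ Fin n) ℂ}
    (hA : A ∈ JUnitary n) {X Y : Matrix (Fin n) (Fin n) ℂ}
    (h : Y * (A.toBlocks₁₁ + A.toBlocks₁₂ * X) = A.toBlocks₂₁ + A.toBlocks₂₂ * X) :
    (imPart Y).rank = (imPart X).rank := by
  have hu := isUnit_det_denominator hA h
  rw [← conjTranspose_mul_imPart_mul hA h, Matrix.rank_mul_eq_left_of_isUnit_det _ _ hu,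
    Matrix.rank_mul_eq_right_of_isUnit_det _ _ (by rw [Matrix.det_conjTranspose]; exact hu.star)]

lemma one_mem_JUnitary : (1 : Matrix (Fin n ⊕ Fin n) (Fin n ⊕ Fin n) ℂ) ∈ JUnitary n := by
  simp [JUnitary]

/-- Linear fractional transformations can be inverted: `A = (A B⁻¹) B` with `A B⁻¹` again
`J`-unitary. -/
lemma exists_mem_JUnitary_mul_eq {A B : Matrix (Fin n ⊕ Fin n) (Fin n ⊕ Fin n) ℂ}
    (hA : A ∈ JUnitary n) (hB : B ∈ JUnitary n) : ∃ A' ∈ JUnitary n, A = A' * B := by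
  have hA' : A.conjTranspose * Matrix.J (Fin n) ℂ * A = Matrix.J (Fin n) ℂ := hA
  have hB' : B.conjTranspose * Matrix.J (Fin n) ℂ * B = Matrix.J (Fin n) ℂ := hB
  set C := -(Matrix.J (Fin n) ℂ * B.conjTranspose * Matrix.J (Fin n) ℂ) with hC
  have hCB : C * B = 1 := by
    have : C * B = -(Matrix.J (Fin n) ℂ * (B.conjTranspose * Matrix.J (Fin n) ℂ * B)) := by
      rw [hC]; noncomm_ring
    rw [this, hB', Matrix.J_squared, neg_neg]
  have hBC : B * C = 1 := mul_eq_one_comm.1 hCB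
  have hCB' : C.conjTranspose * B.conjTranspose = 1 := by
    rw [← Matrix.conjTranspose_mul, hBC, Matrix.conjTranspose_one]
  refine ⟨A * C, ?_, by rw [mul_assoc, hCB, mul_one]⟩
  change (A * C).conjTranspose * Matrix.J (Fin n) ℂ * (A * C) = Matrix.J (Fin n) ℂ
  calc (A * C).conjTranspose * Matrix.J (Fin n) ℂ * (A * C)
      = C.conjTranspose * (A.conjTranspose * Matrix.J (Fin n) ℂ * A) * C := by
        rw [Matrix.conjTranspose_mul]; simp only [mul_assoc]
    _ = C.conjTranspose * (B.conjTranspose * Matrix.J (Fin n) ℂ * B) * C := by rw [hA', hB']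
    _ = (C.conjTranspose * B.conjTranspose) * Matrix.J (Fin n) ℂ * (B * C) := by
        simp only [mul_assoc]
    _ = Matrix.J (Fin n) ℂ := by rw [hCB', hBC, one_mul, mul_one]

lemma toBlocks_mul (A B : Matrix (Fin n ⊕ Fin n) (Fin n ⊕ Fin n) ℂ) :
    (A * B).toBlocks₁₁ = A.toBlocks₁₁ * B.toBlocks₁₁ + A.toBlocks₁₂ * B.toBlocks₂₁ ∧
    (A * B).toBlocks₁₂ = A.toBlocks₁₁ * B.toBlocks₁₂ + A.toBlocks₁₂ * B.toBlocks₂₂ ∧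
    (A * B).toBlocks₂₁ = A.toBlocks₂₁ * B.toBlocks₁₁ + A.toBlocks₂₂ * B.toBlocks₂₁ ∧
    (A * B).toBlocks₂₂ = A.toBlocks₂₁ * B.toBlocks₁₂ + A.toBlocks₂₂ * B.toBlocks₂₂ := by
  rw [← Matrix.fromBlocks_inj, Matrix.fromBlocks_toBlocks, ← Matrix.fromBlocks_multiply,
    Matrix.fromBlocks_toBlocks, Matrix.fromBlocks_toBlocks]

lemma Admissible.isUnit_det {M : ℂ → Matrix (Fin n) (Fin n) ℂ}
    {A : Matrix (Fin n ⊕ Fin n) (Fin n ⊕ Fin n) ℂ} (hA : Admissible M A) {z : ℂ}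
    (hz : 0 < z.im) : IsUnit (A.toBlocks₁₁ + A.toBlocks₁₂ * M z).det := by
  rw [isUnit_iff_ne_zero]
  intro h
  obtain ⟨v, hv, hv0⟩ := Matrix.exists_mulVec_eq_zero_iff.2 h
  exact hv (hA.2 z hz v hv0)

lemma Admissible.transform_mul {M : ℂ → Matrix (Fin n) (Fin n) ℂ}
    {A : Matrix (Fin n ⊕ Fin n) (Fin n ⊕ Fin n) ℂ} (hA : Admissible M A) {z : ℂ}
    (hz : 0 < z.im) : transform A M z * (A.toBlocks₁₁ + A.toBlocks₁₂ * M z) =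
      A.toBlocks₂₁ + A.toBlocks₂₂ * M z := by
  rw [transform, Matrix.nonsing_inv_mul_cancel_right _ _ (hA.isUnit_det hz)]

/-- Two transforms of the same function are linear fractional transforms of each other, with
invertible denominator in the upper half-plane. -/
lemma Admissible.transform_mul_of_mul {M : ℂ → Matrix (Fin n) (Fin n) ℂ}
    {A' B : Matrix (Fin n ⊕ Fin n) (Fin n ⊕ Fin n) ℂ} (hA : Admissible M (A' * B))
    (hB : Admissible M B) {z : ℂ} (hz : 0 < z.im) :
    IsUnit (A'.toBlocks₁₁ + A'.toBlocks₁₂ * transform B M z).det ∧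
    transform (A' * B) M z * (A'.toBlocks₁₁ + A'.toBlocks₁₂ * transform B M z) =
      A'.toBlocks₂₁ + A'.toBlocks₂₂ * transform B M z := by
  obtain ⟨h1, h2, h3, h4⟩ := toBlocks_mul A' B
  have hu := hA.isUnit_det hz
  have ht := hA.transform_mul hz
  have hB1 := hB.transform_mul hz
  have hBu := hB.isUnit_det hz
  have e1 : (A' * B).toBlocks₁₁ + (A' * B).toBlocks₁₂ * M z =
      (A'.toBlocks₁₁ + A'.toBlocks₁₂ * transform B M z) *
        (B.toBlocks₁₁ + B.toBlocks₁₂ * M z) := by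
    rw [add_mul, mul_assoc, hB1, h1, h2]
    noncomm_ring
  have e2 : (A' * B).toBlocks₂₁ + (A' * B).toBlocks₂₂ * M z =
      (A'.toBlocks₂₁ + A'.toBlocks₂₂ * transform B M z) *
        (B.toBlocks₁₁ + B.toBlocks₁₂ * M z) := by
    rw [add_mul, mul_assoc (A'.toBlocks₂₂), hB1, h3, h4]
    noncomm_ring
  rw [e1, Matrix.det_mul] at hu
  refine ⟨isUnit_of_mul_isUnit_left hu, ?_⟩
  rw [e1, e2, ← mul_assoc] at ht
  have := congrArg (· * (B.toBlocks₁₁ + B.toBlocks₁₂ * M z)⁻¹) ht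
  simpa only [Matrix.mul_nonsing_inv_cancel_right _ _ hBu] using this

end HerglotzMatrix

/-! ### Boundary values of Herglotz matrices -/

namespace HerglotzMatrix

variable {n : ℕ} {M : ℂ → Matrix (Fin n) (Fin n) ℂ} {Ω : MatrixMeasure n}

lemma IsHerglotzMeasure.quadForm_eq (h : IsHerglotzMeasure M Ω) :
    ∃ c d : (Fin n → ℂ) → ℝ, (∀ x, 0 ≤ d x) ∧ ∀ z : ℂ, 0 < z.im → ∀ x,
      quadForm (M z) x = nevanlinna (c x) (d x) (Ω.quadMeasure x) z := by
  obtain ⟨-, C, D, hC, hD, h⟩ := h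
  refine ⟨fun x => (quadForm C x).re, fun x => (quadForm D x).re, fun x => ?_, fun z hz x => ?_⟩
  · exact (Complex.le_def.1 (hD.dotProduct_mulVec_nonneg x)).1
  · have hre : ∀ {E : Matrix (Fin n) (Fin n) ℂ}, E.IsHermitian →
        quadForm E x = ((quadForm E x).re : ℂ) := fun {E} hE => by
      have h1 := quadForm_conjTranspose E x
      rw [hE.eq, Complex.star_def] at h1
      exact (Complex.conj_eq_iff_re.1 h1.symm).symm
    rw [nevanlinna, ← hre hC, ← hre hD.isHermitian]
    exact h z hz x

lemma IsHerglotzMeasure.integrable_trace (h : IsHerglotzMeasure M Ω) :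
    Integrable (fun t : ℝ => (1 + t ^ 2)⁻¹) Ω.trace := by
  rw [MatrixMeasure.trace]
  exact integrable_finsetSum_measure.2 fun j _ => h.1 _

/-- The trace of a Herglotz matrix is a scalar Nevanlinna function, with the trace measure. -/
lemma IsHerglotzMeasure.trace_eq (h : IsHerglotzMeasure M Ω) :
    ∃ c d : ℝ, 0 ≤ d ∧ ∀ z : ℂ, 0 < z.im → (M z).trace = nevanlinna c d Ω.trace z := by
  obtain ⟨c, d, hd, hq⟩ := h.quadForm_eq
  refine ⟨∑ j, c (Pi.single j 1), ∑ j, d (Pi.single j 1), Finset.sum_nonneg fun j _ => hd _,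
    fun z hz => ?_⟩
  rw [nevanlinna, MatrixMeasure.trace, integral_finsetSum_measure fun j _ =>
    integrable_nevanlinnaKernel_of_im_pos (h.1 _) hz, Matrix.trace]
  push_cast
  rw [Finset.mul_sum, ← Finset.sum_add_distrib, ← Finset.sum_add_distrib]
  refine Finset.sum_congr rfl fun j _ => ?_
  rw [Matrix.diag_apply, ← quadForm_single (M z), hq z hz, nevanlinna]

lemma IsHerglotzMeasure.imPart_posSemidef (h : IsHerglotzMeasure M Ω) {z : ℂ} (hz : 0 < z.im) :
    (imPart (M z)).PosSemidef := by
  obtain ⟨c, d, hd, hq⟩ := h.quadForm_eq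
  rw [imPart_posSemidef_iff]
  intro x
  rw [hq z hz]
  exact nevanlinna_im_nonneg (h.1 x) _ (hd x) hz

lemma IsHerglotzMeasure.boundary_imPart_posSemidef (h : IsHerglotzMeasure M Ω) {t : ℝ}
    {L : Matrix (Fin n) (Fin n) ℂ} (hL : HasBoundaryValue M t L) : (imPart L).PosSemidef := by
  rw [imPart_posSemidef_iff]
  intro x
  have h1 : Tendsto (fun ε : ℝ => (quadForm (M ((t : ℂ) + ε * Complex.I)) x).im) (𝓝[>] 0)
      (𝓝 (quadForm L x).im) :=
    ((Complex.continuous_im.comp (continuous_quadForm x)).tendsto L).comp hL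
  refine ge_of_tendsto h1 ?_
  filter_upwards [self_mem_nhdsWithin] with ε (hε : 0 < ε)
  exact (imPart_posSemidef_iff _).1 (h.imPart_posSemidef (by simpa using hε)) x

lemma IsHerglotzMeasure.boundary_imPart_eq_zero_iff (h : IsHerglotzMeasure M Ω) {t : ℝ}
    {L : Matrix (Fin n) (Fin n) ℂ} (hL : HasBoundaryValue M t L) :
    imPart L = 0 ↔ L.trace.im = 0 := by
  rw [← (h.boundary_imPart_posSemidef hL).trace_eq_zero_iff, trace_imPart]
  exact_mod_cast Iff.rfl

lemma tendsto_trace_im {t : ℝ} {L : Matrix (Fin n) (Fin n) ℂ} (hL : HasBoundaryValue M t L) :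
    Tendsto (fun ε : ℝ => (M ((t : ℂ) + ε * Complex.I)).trace.im) (𝓝[>] 0) (𝓝 L.trace.im) := by
  have hc : Continuous fun X : Matrix (Fin n) (Fin n) ℂ => X.trace.im := by fun_prop
  exact (hc.tendsto L).comp hL

lemma tendsto_vertical_congr {α : Type*} {l : Filter α} {f g : ℂ → α}
    (hfg : ∀ z : ℂ, 0 < z.im → f z = g z) {t : ℝ}
    (h : Tendsto (fun ε : ℝ => f ((t : ℂ) + ε * Complex.I)) (𝓝[>] 0) l) :
    Tendsto (fun ε : ℝ => g ((t : ℂ) + ε * Complex.I)) (𝓝[>] 0) l := by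
  refine h.congr' ?_
  filter_upwards [self_mem_nhdsWithin] with ε (hε : 0 < ε)
  exact hfg _ (by simpa using hε)

/-- Boundary values of the quadratic forms in finitely many directions give boundary values of the
matrix. -/
lemma HasBoundaryValue.of_quadForm {t : ℝ} {q : (Fin n → ℂ) → ℂ}
    (h : ∀ x ∈ ⋃ j, ⋃ k, ({Pi.single j 1, Pi.single j 1 + Pi.single k 1,
      Pi.single j 1 + Complex.I • Pi.single k 1} : Set (Fin n → ℂ)),
      Tendsto (fun ε : ℝ => quadForm (M ((t : ℂ) + ε * Complex.I)) x) (𝓝[>] 0) (𝓝 (q x))) :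
    HasBoundaryValue M t (polar q) := by
  simp only [Set.mem_iUnion, Set.mem_insert_iff, Set.mem_singleton_iff] at h
  refine tendsto_pi_nhds.2 fun j => tendsto_pi_nhds.2 fun k => ?_
  have e : (fun ε : ℝ => M ((t : ℂ) + ε * Complex.I) j k) =
      fun ε : ℝ => polar (quadForm (M ((t : ℂ) + ε * Complex.I))) j k := by
    funext ε; rw [polar_quadForm]
  rw [e]
  have h1 := h _ ⟨j, k, Or.inl rfl⟩
  have h2 := h _ ⟨k, k, Or.inl rfl⟩
  have h3 := h _ ⟨j, k, Or.inr (Or.inl rfl)⟩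
  have h4 := h _ ⟨j, k, Or.inr (Or.inr rfl)⟩
  exact (((h3.sub h1).sub h2).sub (((h4.sub h1).sub h2).const_mul Complex.I)).const_mul (1 / 2)

lemma IsHerglotzMeasure.ae_exists_hasBoundaryValue (h : IsHerglotzMeasure M Ω) :
    ∀ᵐ t : ℝ, ∃ L, HasBoundaryValue M t L := by
  obtain ⟨c, d, hd, hq⟩ := h.quadForm_eq
  set S : Set (Fin n → ℂ) := ⋃ j, ⋃ k, ({Pi.single j 1, Pi.single j 1 + Pi.single k 1,
      Pi.single j 1 + Complex.I • Pi.single k 1} : Set (Fin n → ℂ)) with hS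
  have hSc : S.Countable := Set.countable_iUnion fun j => Set.countable_iUnion fun k =>
    (Set.toFinite _).countable
  filter_upwards [(ae_ball_iff hSc).2 fun x _ =>
    ae_exists_tendsto_nevanlinna (h.1 x) (c x) (hd x)] with t ht
  choose! q hq' using ht
  exact ⟨polar q, HasBoundaryValue.of_quadForm fun x hx =>
    tendsto_vertical_congr (fun z hz => (hq z hz x).symm) (hq' x hx)⟩

lemma IsHerglotzMeasure.ae_imPart_eq_zero_iff (h : IsHerglotzMeasure M Ω) :
    ∀ᵐ t : ℝ, ∀ L, HasBoundaryValue M t L →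
      (imPart L = 0 ↔ Ω.trace.rnDeriv volume t = 0) := by
  obtain ⟨c, d, hd, hq⟩ := h.trace_eq
  filter_upwards [ae_tendsto_im_nevanlinna_eq_zero_iff h.integrable_trace c hd] with t ht L hL
  rw [h.boundary_imPart_eq_zero_iff hL]
  exact ht _ (tendsto_vertical_congr (f := fun z => (M z).trace.im)
    (g := fun z => (nevanlinna c d Ω.trace z).im) (fun z hz => by rw [hq z hz])
    (tendsto_trace_im hL))

lemma mem_acSupport_iff {t : ℝ} :
    t ∈ acSupport M ↔ ∃ L, HasBoundaryValue M t L ∧ imPart L ≠ 0 := by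
  simp only [acSupport, acSet, Set.mem_iUnion, Set.mem_Icc, Set.mem_ofPred_eq]
  constructor
  · rintro ⟨r, ⟨hr, -⟩, L, hL, hrank⟩
    refine ⟨L, hL, fun h0 => ?_⟩
    rw [h0, Matrix.rank_zero] at hrank
    omega
  · rintro ⟨L, hL, h0⟩
    refine ⟨(imPart L).rank, ⟨?_, ?_⟩, L, hL, rfl⟩
    · exact Nat.one_le_iff_ne_zero.2 fun h => h0 ((rank_eq_zero_iff _).1 h)
    · simpa using (imPart L).rank_le_card_width

/-- Up to a Lebesgue null set, `acSupport M` is the set where the density of the absolutely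
continuous part of the trace measure is nonzero. -/
lemma IsHerglotzMeasure.acSupport_ae_eq (h : IsHerglotzMeasure M Ω) :
    acSupport M =ᵐ[volume] {t | Ω.trace.rnDeriv volume t ≠ 0} := by
  refine eventuallyEq_set.2 ?_
  filter_upwards [h.ae_exists_hasBoundaryValue, h.ae_imPart_eq_zero_iff] with t ⟨L, hL⟩ ht
  rw [mem_acSupport_iff, ← not_iff_not, not_not, ← ht L hL]
  constructor
  · intro h1
    by_contra h2
    exact h1 ⟨L, hL, h2⟩
  · rintro h1 ⟨L', hL', h2⟩
    exact h2 (tendsto_nhds_unique hL' hL ▸ h1)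

end HerglotzMatrix

/-! ### Supports of the absolutely continuous part -/

namespace MatrixMeasure

variable {n : ℕ}

lemma acPart_trace (Ω : MatrixMeasure n) :
    Ω.acPart.trace = volume.withDensity (Ω.trace.rnDeriv volume) := by
  rw [acPart, trace_restrict]
  conv_lhs => rw [Ω.trace.haveLebesgueDecomposition_add volume]
  have hnull : volume (Ω.acCarrierᶜ) = 0 := Measure.MutuallySingular.measure_compl_nullSet _
  rw [Measure.restrict_add, acCarrier, Measure.MutuallySingular.restrict_nullSet, zero_add]
  refine Measure.restrict_eq_self_of_ae_mem ?_
  exact (withDensity_absolutelyContinuous volume (Ω.trace.rnDeriv volume)) hnull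

lemma acPart_trace_eq_zero_iff (Ω : MatrixMeasure n) (S : Set ℝ) :
    Ω.acPart.trace S = 0 ↔ volume ({t | Ω.trace.rnDeriv volume t ≠ 0} ∩ S) = 0 := by
  rw [acPart_trace, withDensity_apply_eq_zero (Measure.measurable_rnDeriv _ _)]

lemma acPart_setEquiv_iff (Ω : MatrixMeasure n) (S T : Set ℝ) :
    Ω.acPart.SetEquiv S T ↔ S =ᵐ[volume] T := by
  rw [SetEquiv, measure_symmDiff_eq_zero_iff, measure_symmDiff_eq_zero_iff]
  exact ⟨fun h => h.2, fun h => ⟨Ω.acPart_absolutelyContinuous.ae_le h, h⟩⟩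

/-- The minimal supports of the absolutely continuous part are the sets which agree almost
everywhere with the set where its density is nonzero. -/
lemma acPart_isMinimalSupport_iff (Ω : MatrixMeasure n) (T : Set ℝ) :
    Ω.acPart.IsMinimalSupport T ↔ T =ᵐ[volume] {t | Ω.trace.rnDeriv volume t ≠ 0} := by
  set P : Set ℝ := {t | Ω.trace.rnDeriv volume t ≠ 0} with hP
  have hsupp : ∀ T, Ω.acPart.IsSupport T ↔ volume (P \ T) = 0 := fun T =>
    Ω.acPart_trace_eq_zero_iff Tᶜ
  rw [ae_eq_set]
  constructor
  · rintro ⟨h1, h2⟩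
    refine ⟨?_, (hsupp T).1 h1⟩
    have h3 := h2 (T ∩ P) Set.inter_subset_left ((hsupp _).2 ?_)
    · rwa [Set.sdiff_self_inter] at h3
    · rw [Set.inter_comm, Set.sdiff_self_inter]
      exact (hsupp T).1 h1
  · rintro ⟨h1, h2⟩
    refine ⟨(hsupp T).2 h2, fun T' _ hT' => ?_⟩
    refine measure_mono_null (t := (T \ P) ∪ (P \ T')) ?_
      (measure_union_null h1 ((hsupp T').1 hT'))
    rintro t ⟨ht, ht'⟩
    by_cases hp : t ∈ P
    · exact Or.inr ⟨hp, ht'⟩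
    · exact Or.inl ⟨ht, hp⟩

lemma acPart_equivalent {Ω Ω' : MatrixMeasure n}
    (h : ({t | Ω.trace.rnDeriv volume t ≠ 0} : Set ℝ) =ᵐ[volume]
      {t | Ω'.trace.rnDeriv volume t ≠ 0}) : Ω.acPart.Equivalent Ω'.acPart := by
  have key : ∀ S, Ω.acPart.trace S = 0 ↔ Ω'.acPart.trace S = 0 := fun S => by
    rw [acPart_trace_eq_zero_iff, acPart_trace_eq_zero_iff]
    exact (measure_congr (h.inter (ae_eq_refl S))).congr_left
  exact ⟨fun S hS => (key S).2 hS, fun S hS => (key S).1 hS⟩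

end MatrixMeasure

/-! ### Boundary values of transforms and the exceptional set -/

namespace HerglotzMatrix

variable {n : ℕ} {M : ℂ → Matrix (Fin n) (Fin n) ℂ} {Ω : MatrixMeasure n}

/-- At each point where two functions related by a linear fractional transformation both have
boundary values, these are related by the same transformation. -/
lemma HasBoundaryValue.mul_denominator {F : ℂ → Matrix (Fin n) (Fin n) ℂ}
    {A : Matrix (Fin n ⊕ Fin n) (Fin n ⊕ Fin n) ℂ} {t : ℝ} {L L' : Matrix (Fin n) (Fin n) ℂ}
    (hF : ∀ z : ℂ, 0 < z.im → F z * (A.toBlocks₁₁ + A.toBlocks₁₂ * M z) =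
      A.toBlocks₂₁ + A.toBlocks₂₂ * M z)
    (hL : HasBoundaryValue M t L) (hL' : HasBoundaryValue F t L') :
    L' * (A.toBlocks₁₁ + A.toBlocks₁₂ * L) = A.toBlocks₂₁ + A.toBlocks₂₂ * L := by
  have h1 : Tendsto (fun ε : ℝ => F ((t : ℂ) + ε * Complex.I) *
      (A.toBlocks₁₁ + A.toBlocks₁₂ * M ((t : ℂ) + ε * Complex.I))) (𝓝[>] 0)
      (𝓝 (L' * (A.toBlocks₁₁ + A.toBlocks₁₂ * L))) :=
    Tendsto.mul hL' (Tendsto.const_add _ (Tendsto.const_mul _ hL))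
  have h2 : Tendsto (fun ε : ℝ => A.toBlocks₂₁ + A.toBlocks₂₂ * M ((t : ℂ) + ε * Complex.I))
      (𝓝[>] 0) (𝓝 (A.toBlocks₂₁ + A.toBlocks₂₂ * L)) :=
    Tendsto.const_add _ (Tendsto.const_mul _ hL)
  exact tendsto_nhds_unique (tendsto_vertical_congr
    (f := fun z => F z * (A.toBlocks₁₁ + A.toBlocks₁₂ * M z))
    (g := fun z => A.toBlocks₂₁ + A.toBlocks₂₂ * M z) hF h1) h2

lemma acSet_transform_ae_eq {A : Matrix (Fin n ⊕ Fin n) (Fin n ⊕ Fin n) ℂ}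
    (hA : Admissible M A) (hM : ∀ᵐ t : ℝ, ∃ L, HasBoundaryValue M t L)
    (hMA : ∀ᵐ t : ℝ, ∃ L, HasBoundaryValue (transform A M) t L) (r : ℕ) :
    acSet (transform A M) r =ᵐ[volume] acSet M r := by
  refine eventuallyEq_set.2 ?_
  filter_upwards [hM, hMA] with t ⟨L, hL⟩ ⟨L', hL'⟩
  have hrank := rank_imPart_eq hA.1
    (HasBoundaryValue.mul_denominator (fun _ hz => hA.transform_mul hz) hL hL')
  constructor
  · rintro ⟨K, hK, rfl⟩
    exact ⟨L, hL, by rw [tendsto_nhds_unique hK hL', hrank]⟩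
  · rintro ⟨K, hK, rfl⟩
    exact ⟨L', hL', by rw [tendsto_nhds_unique hK hL, hrank]⟩

lemma acSupport_transform_ae_eq {A : Matrix (Fin n ⊕ Fin n) (Fin n ⊕ Fin n) ℂ}
    (hA : Admissible M A) (hM : ∀ᵐ t : ℝ, ∃ L, HasBoundaryValue M t L)
    (hMA : ∀ᵐ t : ℝ, ∃ L, HasBoundaryValue (transform A M) t L) :
    acSupport (transform A M) =ᵐ[volume] acSupport M :=
  Filter.EventuallyEq.countable_bUnion (Set.to_countable _) fun r _ =>
    acSet_transform_ae_eq hA hM hMA r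

lemma toBlocks_one : (1 : Matrix (Fin n ⊕ Fin n) (Fin n ⊕ Fin n) ℂ).toBlocks₁₁ = 1 ∧
    (1 : Matrix (Fin n ⊕ Fin n) (Fin n ⊕ Fin n) ℂ).toBlocks₁₂ = 0 ∧
    (1 : Matrix (Fin n ⊕ Fin n) (Fin n ⊕ Fin n) ℂ).toBlocks₂₁ = 0 ∧
    (1 : Matrix (Fin n ⊕ Fin n) (Fin n ⊕ Fin n) ℂ).toBlocks₂₂ = 1 := by
  rw [← Matrix.fromBlocks_inj, Matrix.fromBlocks_toBlocks, Matrix.fromBlocks_one]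

lemma admissible_one (M : ℂ → Matrix (Fin n) (Fin n) ℂ) : Admissible M 1 :=
  ⟨one_mem_JUnitary, fun z _ v hv => by simpa [toBlocks_one] using hv⟩

lemma transform_one (M : ℂ → Matrix (Fin n) (Fin n) ℂ) : transform 1 M = M := by
  funext z
  simp [transform, toBlocks_one]

/-- Where `M` has a boundary value, a transform whose imaginary part vanishes in the limit exists
exactly if the imaginary part of the boundary value is zero: the denominator converges, so by
congruence the imaginary part of `M` would have limit zero as well. -/
lemma mem_exceptionalSet_iff {t : ℝ} {L : Matrix (Fin n) (Fin n) ℂ}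
    (hL : HasBoundaryValue M t L) : t ∈ exceptionalSet M ↔ imPart L ≠ 0 := by
  have hIm : Tendsto (fun ε : ℝ => imPart (M ((t : ℂ) + ε * Complex.I))) (𝓝[>] 0)
      (𝓝 (imPart L)) := (continuous_imPart.tendsto L).comp hL
  rw [exceptionalSet, Set.mem_ofPred_eq, not_iff_not]
  constructor
  · rintro ⟨A, hA, h0⟩
    have hc : Continuous fun p : Matrix (Fin n) (Fin n) ℂ × Matrix (Fin n) (Fin n) ℂ =>
        (A.toBlocks₁₁ + A.toBlocks₁₂ * p.1).conjTranspose * p.2 *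
          (A.toBlocks₁₁ + A.toBlocks₁₂ * p.1) := by fun_prop
    have hlim := (hc.tendsto (L, 0)).comp (hL.prodMk_nhds h0)
    simp only [mul_zero, zero_mul] at hlim
    refine tendsto_nhds_unique hIm ?_
    exact tendsto_vertical_congr
      (f := fun z => (A.toBlocks₁₁ + A.toBlocks₁₂ * M z).conjTranspose *
        imPart (transform A M z) * (A.toBlocks₁₁ + A.toBlocks₁₂ * M z))
      (fun z hz => conjTranspose_mul_imPart_mul hA.1 (hA.transform_mul hz)) hlim
  · intro h0
    refine ⟨1, admissible_one M, ?_⟩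
    rw [transform_one, ← h0]
    exact hIm

lemma exceptionalSet_ae_eq (hM : ∀ᵐ t : ℝ, ∃ L, HasBoundaryValue M t L) :
    exceptionalSet M =ᵐ[volume] acSupport M := by
  refine eventuallyEq_set.2 ?_
  filter_upwards [hM] with t ⟨L, hL⟩
  rw [mem_exceptionalSet_iff hL, mem_acSupport_iff]
  exact ⟨fun h => ⟨L, hL, h⟩, fun ⟨L', hL', h⟩ => tendsto_nhds_unique hL' hL ▸ h⟩

end HerglotzMatrix

/-! ### Discrete point measures -/

namespace MatrixMeasure

variable {n : ℕ}

/-- A matrix measure is a discrete point measure exactly if every real number has a neighbourhood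
in which it is the only point that can be charged. -/
lemma isDiscretePoint_iff (Ω : MatrixMeasure n) :
    Ω.IsDiscretePoint ↔ ∀ t : ℝ, ∃ δ > 0, Ω.trace (Metric.ball t δ \ {t}) = 0 := by
  have hatom : ∀ t, t ∉ Ω.atoms ↔ Ω.trace {t} = 0 := fun t => by
    rw [Ω.trace_eq_zero_iff (measurableSet_singleton t) Bornology.isBounded_singleton]
    simp [atoms]
  constructor
  · rintro ⟨h1, h2⟩ t
    have h3 := h2 t
    rw [accPt_iff_frequently_nhdsNE, not_frequently] at h3
    obtain ⟨δ, hδ, hsub⟩ := Metric.mem_nhdsWithin_iff.1 h3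
    exact ⟨δ, hδ, measure_mono_null (fun s hs => hsub hs) h1⟩
  · intro h
    have hno : ∀ {t δ s : ℝ}, Ω.trace (Metric.ball t δ \ {t}) = 0 →
        s ∈ Metric.ball t δ \ {t} → s ∉ Ω.atoms := fun h0 hs =>
      (hatom _).2 (measure_mono_null (Set.singleton_subset_iff.2 hs) h0)
    refine ⟨measure_null_of_locally_null _ fun t ht => ?_, fun t hacc => ?_⟩
    · obtain ⟨δ, hδ, h0⟩ := h t
      refine ⟨Metric.ball t δ, mem_nhdsWithin_of_mem_nhds (Metric.ball_mem_nhds t hδ), ?_⟩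
      refine measure_mono_null (t := Metric.ball t δ \ {t} ∪ {t}) (fun s hs => ?_)
        (measure_union_null h0 ((hatom t).1 ht))
      by_cases hst : s = t
      · exact Or.inr hst
      · exact Or.inl ⟨hs, hst⟩
    · obtain ⟨δ, hδ, h0⟩ := h t
      rw [accPt_iff_frequently_nhdsNE] at hacc
      refine hacc (Metric.mem_nhdsWithin_iff.2 ⟨δ, hδ, fun s hs => ?_⟩)
      exact hno h0 hs

lemma quadMeasure_eq_zero_of_trace (Ω : MatrixMeasure n) (x : Fin n → ℂ) {X : Set ℝ}
    (hX : MeasurableSet X) (hb : Bornology.IsBounded X) (h : Ω.trace X = 0) :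
    Ω.quadMeasure x X = 0 := by
  rw [Ω.quadMeasure_apply x hX hb, quad, (Ω.trace_eq_zero_iff hX hb).1 h]
  simp

end MatrixMeasure

lemma preimage_ofReal_ball (t δ : ℝ) :
    {s : ℝ | (s : ℂ) ∈ Metric.ball (t : ℂ) δ} = Metric.ball t δ := by
  ext s
  simp only [Set.mem_ofPred_eq, Metric.mem_ball, dist_eq_norm, ← Complex.ofReal_sub,
    Complex.norm_real]

/-- Near an isolated point of the support of the measure, a Nevanlinna function has at most a
pole. -/
lemma meromorphicAt_nevanlinna {μ : Measure ℝ}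
    (hμ : Integrable (fun t : ℝ => (1 + t ^ 2)⁻¹) μ) (c d : ℝ) {t δ : ℝ} (hδ : 0 < δ)
    (h0 : μ (Metric.ball t δ \ {t}) = 0) : MeromorphicAt (nevanlinna c d μ) t := by
  have hreg : AnalyticAt ℂ (nevanlinna c d (μ.restrict {t}ᶜ)) t := by
    refine (differentiableOn_nevanlinna (U := Metric.ball (t : ℂ) δ) hμ.restrict c d
      Metric.isOpen_ball ?_).analyticAt (Metric.ball_mem_nhds _ hδ)
    rw [preimage_ofReal_ball, Measure.restrict_apply Metric.isOpen_ball.measurableSet]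
    exact h0
  have hpole : MeromorphicAt (fun z : ℂ => (μ.real {t} : ℂ) * nevanlinnaKernel z t) t := by
    unfold nevanlinnaKernel
    fun_prop
  refine (hreg.meromorphicAt.add hpole).congr ?_
  have hball : Metric.ball (t : ℂ) (δ / 2) ∈ 𝓝[≠] (t : ℂ) :=
    mem_nhdsWithin_of_mem_nhds (Metric.ball_mem_nhds _ (by positivity))
  filter_upwards [hball, self_mem_nhdsWithin] with z hz hzt
  have hzt' : 0 < ‖(t : ℂ) - z‖ := norm_pos_iff.2 (sub_ne_zero.2 (Ne.symm hzt))
  have hint : Integrable (nevanlinnaKernel z) μ := by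
    refine integrable_nevanlinnaKernel hμ (r := min ‖(t : ℂ) - z‖ (δ / 2))
      (lt_min hzt' (by positivity)) ?_
    have : ∀ᵐ s : ℝ ∂μ, s ∉ Metric.ball t δ \ {t} := by
      rw [ae_iff]; simp only [not_not]; exact h0
    filter_upwards [this] with s hs
    by_cases hst : s = t
    · rw [hst]; exact min_le_left _ _
    · refine (min_le_right _ _).trans ?_
      have h1 : δ ≤ ‖(s : ℂ) - t‖ := by
        by_contra hcon
        refine hs ⟨?_, hst⟩
        rw [Metric.mem_ball, dist_eq_norm, ← Complex.norm_real, Complex.ofReal_sub]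
        exact not_le.1 hcon
      rw [Metric.mem_ball, dist_eq_norm] at hz
      have h2 := norm_add_le ((s : ℂ) - z) (z - t)
      rw [sub_add_sub_cancel] at h2
      linarith
  rw [Pi.add_apply, nevanlinna, nevanlinna,
    ← integral_add_compl (measurableSet_singleton t) hint, integral_singleton, Complex.real_smul]
  ring

namespace HerglotzMatrix

variable {n : ℕ}

lemma meromorphicAt_det {E : ℂ → Matrix (Fin n) (Fin n) ℂ} {t : ℂ}
    (h : ∀ j k, MeromorphicAt (fun z => E z j k) t) : MeromorphicAt (fun z => (E z).det) t := by
  simp only [Matrix.det_apply']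
  exact MeromorphicAt.fun_sum fun σ _ =>
    (MeromorphicAt.const _ _).mul (MeromorphicAt.fun_prod fun i _ => h _ _)

/-- Discreteness of the measure is preserved under linear fractional transformations. The function
`F` continues meromorphically to a neighbourhood of each real point, with Hermitian values on the
punctured real neighbourhood; the denominator of the transformation is meromorphic and not
identically zero, so it is invertible near the point, and the imaginary part of the transform `G`
has boundary value zero at all real points near the given one, which its measure hence does not
charge. -/
lemma isDiscretePoint_of_linearFractional {F G : ℂ → Matrix (Fin n) (Fin n) ℂ}
    {Ω Ω' : MatrixMeasure n} {A : Matrix (Fin n ⊕ Fin n) (Fin n ⊕ Fin n) ℂ}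
    (hA : A ∈ JUnitary n) (hF : IsHerglotzMeasure F Ω) (hG : IsHerglotzMeasure G Ω')
    (hu : ∀ z : ℂ, 0 < z.im → IsUnit (A.toBlocks₁₁ + A.toBlocks₁₂ * F z).det)
    (hFG : ∀ z : ℂ, 0 < z.im → G z * (A.toBlocks₁₁ + A.toBlocks₁₂ * F z) =
      A.toBlocks₂₁ + A.toBlocks₂₂ * F z) (hΩ : Ω.IsDiscretePoint) : Ω'.IsDiscretePoint := by
  rw [MatrixMeasure.isDiscretePoint_iff] at hΩ ⊢
  intro t
  obtain ⟨δ, hδ, h0⟩ := hΩ t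
  obtain ⟨c, d, hd, hq⟩ := hF.quadForm_eq
  obtain ⟨c₁, d₁, hd₁, htr⟩ := hF.trace_eq
  obtain ⟨c₂, d₂, hd₂, htr'⟩ := hG.trace_eq
  have hX : MeasurableSet (Metric.ball t δ \ {t}) :=
    Metric.isOpen_ball.measurableSet.diff (measurableSet_singleton t)
  have h0q : ∀ x, Ω.quadMeasure x (Metric.ball t δ \ {t}) = 0 := fun x =>
    Ω.quadMeasure_eq_zero_of_trace x hX (Metric.isBounded_ball.subset Set.sdiff_subset) h0
  -- the meromorphic continuation of `F`
  set E : ℂ → Matrix (Fin n) (Fin n) ℂ := fun z =>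
    polar fun x => nevanlinna (c x) (d x) (Ω.quadMeasure x) z with hE
  have hEF : ∀ z : ℂ, 0 < z.im → E z = F z := fun z hz => by
    rw [← polar_quadForm (F z)]
    exact congrArg polar (funext fun x => (hq z hz x).symm)
  have hm : ∀ x, MeromorphicAt (nevanlinna (c x) (d x) (Ω.quadMeasure x)) t := fun x =>
    meromorphicAt_nevanlinna (hF.1 x) _ _ hδ (h0q x)
  have hEm : ∀ j k, MeromorphicAt (fun z => E z j k) t := fun j k =>
    (MeromorphicAt.const _ _).mul ((((hm _).sub (hm _)).sub (hm _)).sub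
      ((MeromorphicAt.const _ _).mul (((hm _).sub (hm _)).sub (hm _))))
  have hdet : MeromorphicAt (fun z => (A.toBlocks₁₁ + A.toBlocks₁₂ * E z).det) t := by
    refine meromorphicAt_det fun j k => ?_
    simp only [Matrix.add_apply, Matrix.mul_apply]
    exact (MeromorphicAt.const _ _).add (MeromorphicAt.fun_sum fun i _ =>
      (MeromorphicAt.const _ _).mul (hEm i k))
  have hne : ∀ᶠ z in 𝓝[≠] (t : ℂ), (A.toBlocks₁₁ + A.toBlocks₁₂ * E z).det ≠ 0 := by
    refine hdet.eventually_eq_zero_or_eventually_ne_zero.resolve_left fun hz => ?_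
    have hv : Tendsto (fun ε : ℝ => (t : ℂ) + ε * Complex.I) (𝓝[>] 0) (𝓝[≠] (t : ℂ)) := by
      refine tendsto_nhdsWithin_iff.2 ⟨?_, ?_⟩
      · have : Continuous fun ε : ℝ => (t : ℂ) + ε * Complex.I := by fun_prop
        simpa using (this.tendsto 0).mono_left nhdsWithin_le_nhds
      · filter_upwards [self_mem_nhdsWithin] with ε (hε : 0 < ε)
        simpa using hε.ne'
    obtain ⟨ε, hε, hε0⟩ := ((hv.eventually hz).and self_mem_nhdsWithin).exists
    have him : 0 < ((t : ℂ) + ε * Complex.I).im := by simpa using hε0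
    rw [hEF _ him] at hε
    exact (hu _ him).ne_zero hε
  have hreal : ∀ᶠ s : ℝ in 𝓝[≠] t, (A.toBlocks₁₁ + A.toBlocks₁₂ * E s).det ≠ 0 := by
    have hv : Tendsto (fun s : ℝ => (s : ℂ)) (𝓝[≠] t) (𝓝[≠] (t : ℂ)) := by
      refine tendsto_nhdsWithin_iff.2 ⟨?_, ?_⟩
      · exact (Complex.continuous_ofReal.tendsto t).mono_left nhdsWithin_le_nhds
      · filter_upwards [self_mem_nhdsWithin] with s hs
        simpa using hs
    exact hv.eventually hne
  obtain ⟨δ', hδ', hsub⟩ := Metric.mem_nhdsWithin_iff.1 hreal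
  refine ⟨min δ δ', lt_min hδ hδ', ?_⟩
  have hU : IsOpen (Metric.ball (t : ℂ) δ \ {(t : ℂ)}) :=
    Metric.isOpen_ball.sdiff isClosed_singleton
  have hUnull : ∀ μ : Measure ℝ, μ (Metric.ball t δ \ {t}) = 0 →
      μ {s : ℝ | (s : ℂ) ∈ Metric.ball (t : ℂ) δ \ {(t : ℂ)}} = 0 := fun μ hμ0 => by
    convert hμ0 using 2
    rw [← preimage_ofReal_ball]
    ext s
    simp
  -- at the points of the punctured neighbourhood the imaginary part of `G` has limit zero
  have hlim : ∀ s ∈ Metric.ball t (min δ δ') \ {t},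
      Tendsto (fun ε : ℝ => (nevanlinna c₂ d₂ Ω'.trace (s + ε * Complex.I)).im) (𝓝[>] 0)
        (𝓝 0) := by
    rintro s ⟨hs, hst⟩
    have hsU : (s : ℂ) ∈ Metric.ball (t : ℂ) δ \ {(t : ℂ)} := by
      refine ⟨?_, by simpa using hst⟩
      change s ∈ {s : ℝ | (s : ℂ) ∈ Metric.ball (t : ℂ) δ}
      rw [preimage_ofReal_ball]
      exact Metric.ball_subset_ball (min_le_left _ _) hs
    have hsdet : (A.toBlocks₁₁ + A.toBlocks₁₂ * E s).det ≠ 0 :=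
      hsub ⟨Metric.ball_subset_ball (min_le_right _ _) hs, hst⟩
    have hcont : ∀ {μ : Measure ℝ} (c d : ℝ), Integrable (fun t : ℝ => (1 + t ^ 2)⁻¹) μ →
        μ (Metric.ball t δ \ {t}) = 0 →
        Tendsto (fun ε : ℝ => nevanlinna c d μ (s + ε * Complex.I)) (𝓝[>] 0)
          (𝓝 (nevanlinna c d μ s)) := by
      intro μ c d hμ hμ0
      have h1 : ContinuousAt (nevanlinna c d μ) s :=
        ((differentiableOn_nevanlinna hμ c d hU (hUnull μ hμ0)).differentiableAt
          (hU.mem_nhds hsU)).continuousAt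
      refine h1.tendsto.comp ?_
      have : Continuous fun ε : ℝ => (s : ℂ) + ε * Complex.I := by fun_prop
      simpa using (this.tendsto 0).mono_left nhdsWithin_le_nhds
    have hFs : HasBoundaryValue F s (E s) :=
      HasBoundaryValue.of_quadForm fun x _ =>
        tendsto_vertical_congr (fun z hz => (hq z hz x).symm) (hcont _ _ (hF.1 x) (h0q x))
    have hEs : imPart (E s) = 0 := by
      rw [hF.boundary_imPart_eq_zero_iff hFs, ← nevanlinna_ofReal_im c₁ d₁ Ω.trace s]
      exact tendsto_nhds_unique (tendsto_vertical_congr (f := fun z => (F z).trace.im)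
        (g := fun z => (nevanlinna c₁ d₁ Ω.trace z).im) (fun z hz => by rw [htr z hz])
        (tendsto_trace_im hFs))
        ((Complex.continuous_im.tendsto _).comp (hcont c₁ d₁ hF.integrable_trace h0))
    have hGs : HasBoundaryValue G s ((A.toBlocks₂₁ + A.toBlocks₂₂ * E s) *
        (A.toBlocks₁₁ + A.toBlocks₁₂ * E s)⁻¹) := by
      have hden : Tendsto (fun ε : ℝ => A.toBlocks₁₁ +
          A.toBlocks₁₂ * F ((s : ℂ) + ε * Complex.I)) (𝓝[>] 0)
          (𝓝 (A.toBlocks₁₁ + A.toBlocks₁₂ * E s)) :=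
        Tendsto.const_add _ (Tendsto.const_mul _ hFs)
      have hnum : Tendsto (fun ε : ℝ => A.toBlocks₂₁ +
          A.toBlocks₂₂ * F ((s : ℂ) + ε * Complex.I)) (𝓝[>] 0)
          (𝓝 (A.toBlocks₂₁ + A.toBlocks₂₂ * E s)) :=
        Tendsto.const_add _ (Tendsto.const_mul _ hFs)
      have hinv : ContinuousAt Ring.inverse (A.toBlocks₁₁ + A.toBlocks₁₂ * E s).det := by
        rw [Ring.inverse_eq_inv']
        exact continuousAt_inv₀ hsdet
      refine tendsto_vertical_congr
        (f := fun z => (A.toBlocks₂₁ + A.toBlocks₂₂ * F z) *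
          (A.toBlocks₁₁ + A.toBlocks₁₂ * F z)⁻¹) (fun z hz => ?_)
        (hnum.mul ((continuousAt_matrix_inv _ hinv).tendsto.comp hden))
      rw [← hFG z hz, Matrix.mul_nonsing_inv_cancel_right _ _ (hu z hz)]
    have hG0 : imPart ((A.toBlocks₂₁ + A.toBlocks₂₂ * E s) *
        (A.toBlocks₁₁ + A.toBlocks₁₂ * E s)⁻¹) = 0 := by
      rw [← rank_eq_zero_iff, rank_imPart_eq hA (HasBoundaryValue.mul_denominator hFG hFs hGs),
        hEs, Matrix.rank_zero]
    rw [hG.boundary_imPart_eq_zero_iff hGs] at hG0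
    have h1 := tendsto_trace_im hGs
    rw [hG0] at h1
    exact tendsto_vertical_congr (f := fun z => (G z).trace.im)
      (g := fun z => (nevanlinna c₂ d₂ Ω'.trace z).im) (fun z hz => by rw [htr' z hz]) h1
  have hae := ae_not_tendsto_im_nevanlinna_zero hG.integrable_trace c₂ hd₂
  rw [ae_iff] at hae
  simp only [not_not] at hae
  exact measure_mono_null hlim hae

end HerglotzMatrix

/-! ### Invariance under linear fractional transformations -/

theorem theorem6p6 (n : ℕ) (M : ℂ → Matrix (Fin n) (Fin n) ℂ)
    (hM : HerglotzMatrix.IsHerglotz M)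
    (Ω : MatrixMeasure n) (hΩ : HerglotzMatrix.IsHerglotzMeasure M Ω) :
    -- the class of `S_{Ω_ac}` consists of all minimal supports of `Ω_ac`
    (HerglotzMatrix.acClass M Ω = {T | Ω.acPart.IsMinimalSupport T}) ∧
    -- invariance of the classes and equivalence of the absolutely continuous parts
    (∀ A, HerglotzMatrix.Admissible M A → ∀ Ω_A : MatrixMeasure n,
      HerglotzMatrix.IsHerglotzMeasure (HerglotzMatrix.transform A M) Ω_A →
        (∀ r : ℕ, 1 ≤ r → r ≤ n →
          HerglotzMatrix.acClassRank (HerglotzMatrix.transform A M) Ω_A r =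
            HerglotzMatrix.acClassRank M Ω r) ∧
        HerglotzMatrix.acClass (HerglotzMatrix.transform A M) Ω_A =
          HerglotzMatrix.acClass M Ω ∧
        Ω_A.acPart.Equivalent Ω.acPart) ∧
    -- invariance of discreteness
    (∀ B, HerglotzMatrix.Admissible M B → ∀ Ω_B : MatrixMeasure n,
      HerglotzMatrix.IsHerglotzMeasure (HerglotzMatrix.transform B M) Ω_B →
      Ω_B.IsDiscretePoint →
        ∀ A, HerglotzMatrix.Admissible M A → ∀ Ω_A : MatrixMeasure n,
          HerglotzMatrix.IsHerglotzMeasure (HerglotzMatrix.transform A M) Ω_A →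
            Ω_A.IsDiscretePoint) ∧
    -- the exceptional set belongs to the class of minimal supports
    (HerglotzMatrix.exceptionalSet M ∈ HerglotzMatrix.acClass M Ω) := by
  have hbv := hΩ.ae_exists_hasBoundaryValue
  have hclass : ∀ {F : ℂ → Matrix (Fin n) (Fin n) ℂ} {Ω' : MatrixMeasure n} {T : Set ℝ},
      T ∈ HerglotzMatrix.acClass F Ω' ↔ T =ᵐ[volume] HerglotzMatrix.acSupport F :=
    fun {_ Ω' _} => Ω'.acPart_setEquiv_iff _ _
  refine ⟨?_, fun A hA Ω_A hΩA => ?_, fun B hB Ω_B hΩB hdisc A hA Ω_A hΩA => ?_, ?_⟩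
  · ext T
    rw [hclass, Set.mem_ofPred_eq, Ω.acPart_isMinimalSupport_iff]
    exact ⟨fun h => h.trans hΩ.acSupport_ae_eq, fun h => h.trans hΩ.acSupport_ae_eq.symm⟩
  · have hbvA := hΩA.ae_exists_hasBoundaryValue
    have hS := HerglotzMatrix.acSupport_transform_ae_eq hA hbv hbvA
    refine ⟨fun r _ _ => ?_, ?_, ?_⟩
    · have hr := HerglotzMatrix.acSet_transform_ae_eq hA hbv hbvA r
      ext T
      change Ω_A.acPart.SetEquiv T _ ↔ Ω.acPart.SetEquiv T _
      rw [Ω_A.acPart_setEquiv_iff, Ω.acPart_setEquiv_iff]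
      exact ⟨fun h => h.trans hr, fun h => h.trans hr.symm⟩
    · ext T
      rw [hclass, hclass]
      exact ⟨fun h => h.trans hS, fun h => h.trans hS.symm⟩
    · exact MatrixMeasure.acPart_equivalent
        (hΩA.acSupport_ae_eq.symm.trans (hS.trans hΩ.acSupport_ae_eq))
  · obtain ⟨A', hA', rfl⟩ := HerglotzMatrix.exists_mem_JUnitary_mul_eq hA.1 hB.1
    exact HerglotzMatrix.isDiscretePoint_of_linearFractional hA' hΩB hΩA
      (fun z hz => (hA.transform_mul_of_mul hB hz).1)
      (fun z hz => (hA.transform_mul_of_mul hB hz).2) hdisc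
  · rw [hclass]
    exact HerglotzMatrix.exceptionalSet_ae_eq hbv
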